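/- **Setting.** Let $m,\ell\in\mathbb R$ with $m\neq 0$, $4m\neq\ell^2$, let $F=1+m(x^2+y^2)$, and let $M^3_{m,\ell}$ be the Bianchi-Cartan-Vranceanu space, i.e. $\{(x,y,z)\in\mathbb R^3: F>0\}$ with the standard orientation and the metric $$g=\frac{dx^2+dy^2}{F^2}+\Big[dz+\frac{\ell}{2}\,\frac{y\,dx-x\,dy}{F}\Big]^2 .$$ Let $r\ge 2$ be an integer. A smooth curve $\gamma:I\to M^3_{m,\ell}$ on a nonempty open interval $I$, parametrized by arc length, with $T=\gamma'$, is *$r$-harmonic* if $$\tau_r(\gamma)=\nabla_T^{2r-1}T+\sum_{k=0}^{r-2}(-1)^k R\big(\nabla_T^{2r-3-k}T,\nabla_T^kT\big)T=0,$$ where $R(X,Y)Z=\nabla_X\nabla_YZ-\nabla_Y\nabla_XZ-\nabla_{[X,Y]}Z$, and *proper* $r$-harmonic if moreover it is not a geodesic. It is a *$3$-Frenet helix* if there are constants $\kappa>0$, $\tau\in\mathbb R$ and smooth vector fields $N,B$ along $\gamma$ such that $\{T,N,B\}$ is a positively oriented orthonormal frame and $\nabla_TT=\kappa N$, $\nabla_TN=-\kappa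 T+\tau B$, $\nabla_TB=-\tau N$. For $\alpha\in(0,\pi)$ put $$\begin{aligned}P_4(\zeta)={}&8\zeta^4+16\ell\cos\alpha\,\zeta^3+\big[\cos(2\alpha)\big(16m(r-1)-3\ell^2(r-2)\big)-16m(r-1)+\ell^2(3r+4)\big]\zeta^2\\&+2\ell\cos\alpha\big[\ell^2-2r(4m-\ell^2)\sin^2\alpha\big]\zeta-2\ell^2(4m-\ell^2)\sin^2\alpha .\end{aligned}$$ For $\alpha\in(0,\pi)$ and $\zeta>0$, put $\sigma=\frac1{4m}\big((4m-\ell^2)\cos\alpha-\ell\zeta\big)$. A curve $\gamma=(x,y,z)$ on $I$ is * of **Type I** if $x=\mu\sin\alpha\sin\beta+c_1$, $y=-\mu\sin\alpha\cos\beta+c_2$, $z=\frac{\ell}{4m}\beta+\sigma s+c_3$, with constants $\mu\neq0$, $c_1,c_2,c_3$ such that $c_1^2+c_2^2=\frac{\mu}{m}\big(\ell\cos\alpha+\zeta-\frac1\mu+m\mu\sin^2\alpha\big)$, and $\beta$ a nonconstant solution of $\beta'=2m\sin\alpha\,(c_1\sin\beta-c_2\cos\beta)+2m\mu\sin^2\alpha+\zeta+\ell\cos\alpha$;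 * of **Type II** if $y=x\tan\beta_0+c_1$, $z=\sigma s+c_2$ and $x'=\big(1+m[x^2+(x\tan\beta_0+c_1)^2]\big)\sin\alpha\cos\beta_0$, with constants $\beta_0,c_1,c_2$ such that $\sin\beta_0\cos\beta_0\ne0$ and $c_1=\frac{\zeta+\ell\cos\alpha}{2m\sin\alpha\cos\beta_0}$; * of **Type III** if $z=\sigma s+c_1$ for a constant $c_1$ and, for a constant $\beta_0$, either $\cos\beta_0=0$, $x\equiv x_0=-\frac{\zeta+\ell\cos\alpha}{2m\sin\alpha\sin\beta_0}$ and $(y')^2=(1+m[x_0^2+y^2])^2\sin^2\alpha$, or $\sin\beta_0=0$, $y\equiv y_0=\frac{\zeta+\ell\cos\alpha}{2m\sin\alpha\cos\beta_0}$ and $(x')^2=(1+m[x^2+y_0^2])^2\sin^2\alpha$. **Theorem.** (i) Let $\alpha\in(0,\pi)$ and let $\zeta>0$ satisfy $P_4(\zeta)=0$. Then every $3$-Frenet helix in $M^3_{m,\ell}$ that is of Type I, II or III with these constants $\alpha,\zeta$ is proper $r$-harmonic. (ii) Conversely, for every proper $r$-harmonic $3$-Frenet helix $\gamma:I\to M^3_{m,\ell}$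 there are $\alpha\in(0,\pi)$ and $\zeta>0$ with $P_4(\zeta)=0$ such that $\gamma$, or $\gamma$ with its orientation reversed ($s\mapsto\gamma(-s)$ on $-I$), is of Type I, II or III with constants $\alpha,\zeta$. -/

import Mathlib

/-! Curves in coordinate domains of `ℝ³` carrying a Riemannian metric, and
Bianchi-Cartan-Vranceanu spaces. -/

open Real

noncomputable section

namespace BCV

/-- Points of `ℝ³`, and components of tangent vectors in the coordinate frame `∂x, ∂y, ∂z`. -/
abbrev Vec3 : Type := Fin 3 → ℝ

/-- A metric tensor in coordinates: `g p i j = g(∂ᵢ, ∂ⱼ)` at `p`. -/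
abbrev MetricTensor : Type := Vec3 → Matrix (Fin 3) (Fin 3) ℝ

/-- The partial derivative `∂ᵢ f` at `p`. -/
def partialDeriv (i : Fin 3) (f : Vec3 → ℝ) (p : Vec3) : ℝ :=
  fderiv ℝ f p (Pi.single i 1)

/-- The scalar product `⟨v, w⟩` of two tangent vectors at `p`. -/
def metricInner (g : MetricTensor) (p v w : Vec3) : ℝ :=
  ∑ i, ∑ j, g p i j * v i * w j

/-- Christoffel symbols `Γᵏᵢⱼ` of the Levi-Civita connection of `g`. -/
def christoffel (g : MetricTensor) (k i j : Fin 3) (p : Vec3) : ℝ :=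
  (1 / 2) * ∑ l, (g p)⁻¹ k l *
    (partialDeriv i (fun q => g q j l) p + partialDeriv j (fun q => g q i l) p
      - partialDeriv l (fun q => g q i j) p)

/-- The curvature operator `R(X,Y)Z = ∇_X ∇_Y Z - ∇_Y ∇_X Z - ∇_[X,Y] Z` at `p`. -/
def curvature (g : MetricTensor) (p X Y Z : Vec3) : Vec3 := fun l =>
  ∑ i, ∑ j, ∑ k, X i * Y j * Z k *
    (partialDeriv i (christoffel g l j k) p - partialDeriv j (christoffel g l i k) p
      + ∑ a, (christoffel g l i a p * christoffel g a j k p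
        - christoffel g l j a p * christoffel g a i k p))

/-- The covariant derivative `∇_T V` of a vector field `V` along the curve `γ`, with `T = γ'`. -/
def covDeriv (g : MetricTensor) (γ V : ℝ → Vec3) : ℝ → Vec3 := fun s k =>
  deriv (fun t => V t k) s
    + ∑ i, ∑ j, christoffel g k i j (γ s) * deriv (fun t => γ t i) s * V s j

/-- The tangent field `T = γ'`. -/
def tangent (γ : ℝ → Vec3) : ℝ → Vec3 := fun s i => deriv (fun t => γ t i) s

/-- The iterated covariant derivative `∇_T^k T`. -/
def iterCovTangent (g : MetricTensor) (γ : ℝ → Vec3) (k : ℕ) : ℝ → Vec3 :=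
  (covDeriv g γ)^[k] (tangent γ)

/-- The `r`-tension field
`τ_r(γ) = ∇_T^{2r-1} T + ∑_{l=0}^{r-2} (-1)^l R(∇_T^{2r-3-l} T, ∇_T^l T) T`, for `r ≥ 2`. -/
def rTension (g : MetricTensor) (r : ℕ) (γ : ℝ → Vec3) (s : ℝ) : Vec3 :=
  iterCovTangent g γ (2 * r - 1) s
    + ∑ l ∈ Finset.range (r - 1), (-1 : ℝ) ^ l •
        curvature g (γ s) (iterCovTangent g γ (2 * r - 3 - l) s) (iterCovTangent g γ l s)
          (tangent γ s)

/-- `γ` is a geodesic on `I`. -/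
def IsGeodesicOn (g : MetricTensor) (I : Set ℝ) (γ : ℝ → Vec3) : Prop :=
  ∀ s ∈ I, covDeriv g γ (tangent γ) s = 0

/-- `γ` is proper `r`-harmonic on `I`: its `r`-tension field vanishes and it is not a geodesic. -/
def IsProperRHarmonicOn (g : MetricTensor) (r : ℕ) (I : Set ℝ) (γ : ℝ → Vec3) : Prop :=
  (∀ s ∈ I, rTension g r γ s = 0) ∧ ¬ IsGeodesicOn g I γ

/-- `γ : I → U` is a smooth curve parametrized by arc length, in the domain `U ⊆ ℝ³` with the
metric `g` and the orientation of `ℝ³`, with Frenet `3`-field `{T, N, B}` and curvatures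
`k₁ > 0` and `k₂` (of any sign, since the ambient dimension is `3`). -/
structure IsFrenetCurve3 (g : MetricTensor) (U : Set Vec3) (I : Set ℝ) (γ N B : ℝ → Vec3)
    (k₁ k₂ : ℝ → ℝ) : Prop where
  smooth : ContDiffOn ℝ (⊤ : ℕ∞) γ I
  smooth_N : ContDiffOn ℝ (⊤ : ℕ∞) N I
  smooth_B : ContDiffOn ℝ (⊤ : ℕ∞) B I
  mapsTo : ∀ s ∈ I, γ s ∈ U
  inner_TT : ∀ s ∈ I, metricInner g (γ s) (tangent γ s) (tangent γ s) = 1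
  inner_NN : ∀ s ∈ I, metricInner g (γ s) (N s) (N s) = 1
  inner_BB : ∀ s ∈ I, metricInner g (γ s) (B s) (B s) = 1
  inner_TN : ∀ s ∈ I, metricInner g (γ s) (tangent γ s) (N s) = 0
  inner_TB : ∀ s ∈ I, metricInner g (γ s) (tangent γ s) (B s) = 0
  inner_NB : ∀ s ∈ I, metricInner g (γ s) (N s) (B s) = 0
  oriented : ∀ s ∈ I, 0 < (Matrix.of ![tangent γ s, N s, B s]).det
  k₁_pos : ∀ s ∈ I, 0 < k₁ s
  deriv_T : ∀ s ∈ I, covDeriv g γ (tangent γ) s = k₁ s • N s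
  deriv_N : ∀ s ∈ I, covDeriv g γ N s = -(k₁ s) • tangent γ s + k₂ s • B s
  deriv_B : ∀ s ∈ I, covDeriv g γ B s = -(k₂ s) • N s

/-- `γ` is a `3`-Frenet helix: a `3`-Frenet curve with constant curvatures `κ` and `τ`. -/
def IsFrenetHelix3 (g : MetricTensor) (U : Set Vec3) (I : Set ℝ) (γ : ℝ → Vec3) : Prop :=
  ∃ (N B : ℝ → Vec3) (κ τ : ℝ), IsFrenetCurve3 g U I γ N B (fun _ => κ) (fun _ => τ)

/-- The function `F = 1 + m (x² + y²)`. -/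
def conf (m : ℝ) (p : Vec3) : ℝ := 1 + m * (p 0 ^ 2 + p 1 ^ 2)

/-- The underlying domain `{(x, y, z) : 1 + m (x² + y²) > 0}`. -/
def domain (m : ℝ) : Set Vec3 := {p | 0 < conf m p}

/-- Components of the one-form `dz + (ℓ/2) (y dx - x dy) / (1 + m (x² + y²))`. -/
def vertForm (m ℓ : ℝ) (p : Vec3) : Vec3 :=
  ![ℓ / 2 * (p 1 / conf m p), -(ℓ / 2 * (p 0 / conf m p)), 1]

/-- The metric `(dx² + dy²) / F² + (dz + (ℓ/2) (y dx - x dy) / F)²` of the BCV-space. -/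
def metric (m ℓ : ℝ) : MetricTensor := fun p =>
  Matrix.of fun i j =>
    (Matrix.diagonal ![(1 : ℝ), 1, 0]) i j / conf m p ^ 2 + vertForm m ℓ p i * vertForm m ℓ p j

/-- The quartic `P₄(ζ)`, which depends on `m`, `ℓ`, `r` and the angle `α`. -/
def P4 (m ℓ : ℝ) (r : ℕ) (α ζ : ℝ) : ℝ :=
  8 * ζ ^ 4 + 16 * ℓ * cos α * ζ ^ 3
    + (cos (2 * α) * (16 * m * ((r : ℝ) - 1) - 3 * ℓ ^ 2 * ((r : ℝ) - 2))
        - 16 * m * ((r : ℝ) - 1) + ℓ ^ 2 * (3 * (r : ℝ) + 4)) * ζ ^ 2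
    + 2 * ℓ * cos α * (ℓ ^ 2 - 2 * (r : ℝ) * (4 * m - ℓ ^ 2) * sin α ^ 2) * ζ
    - 2 * ℓ ^ 2 * (4 * m - ℓ ^ 2) * sin α ^ 2

/-- The slope `((4m - ℓ²) cos α - ℓ ζ) / (4m)` of the linear term of `z(s)`. -/
def slope (m ℓ α ζ : ℝ) : ℝ := 1 / (4 * m) * ((4 * m - ℓ ^ 2) * cos α - ℓ * ζ)

/-- Curves of Type I with constants `α` and `ζ`. -/
def IsTypeI (m ℓ α ζ : ℝ) (I : Set ℝ) (γ : ℝ → Vec3) : Prop :=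
  ∃ (μ c₁ c₂ c₃ : ℝ) (β : ℝ → ℝ), μ ≠ 0 ∧
    c₁ ^ 2 + c₂ ^ 2 = μ / m * ((ℓ * cos α + ζ - 1 / μ) + m * μ * sin α ^ 2) ∧
    (∀ s ∈ I, HasDerivAt β
      (2 * m * sin α * (c₁ * sin (β s) - c₂ * cos (β s))
        + 2 * m * μ * sin α ^ 2 + ζ + ℓ * cos α) s) ∧
    (¬ ∃ b, ∀ s ∈ I, β s = b) ∧
    ∀ s ∈ I,
      γ s 0 = μ * sin α * sin (β s) + c₁ ∧
      γ s 1 = -(μ * sin α * cos (β s)) + c₂ ∧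
      γ s 2 = ℓ / (4 * m) * β s + slope m ℓ α ζ * s + c₃

/-- Curves of Type II with constants `α` and `ζ`. -/
def IsTypeII (m ℓ α ζ : ℝ) (I : Set ℝ) (γ : ℝ → Vec3) : Prop :=
  ∃ β₀ c₁ c₂ : ℝ, sin β₀ * cos β₀ ≠ 0 ∧
    c₁ = (ζ + ℓ * cos α) / (2 * m * sin α * cos β₀) ∧
    ∀ s ∈ I,
      HasDerivAt (fun t => γ t 0)
        ((1 + m * (γ s 0 ^ 2 + (γ s 0 * tan β₀ + c₁) ^ 2)) * (sin α * cos β₀)) s ∧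
      γ s 1 = γ s 0 * tan β₀ + c₁ ∧
      γ s 2 = slope m ℓ α ζ * s + c₂

/-- Curves of Type III with constants `α` and `ζ`: the angle `β₀` satisfies
`sin β₀ cos β₀ = 0`, so that either `cos β₀ = 0` and `sin β₀ = ±1`, or `sin β₀ = 0` and
`cos β₀ = ±1`. -/
def IsTypeIII (m ℓ α ζ : ℝ) (I : Set ℝ) (γ : ℝ → Vec3) : Prop :=
  ∃ β₀ c₁ : ℝ,
    (∀ s ∈ I, γ s 2 = slope m ℓ α ζ * s + c₁) ∧
    ((cos β₀ = 0 ∧ ∃ x₀ : ℝ, x₀ = -((ζ + ℓ * cos α) / (2 * m * sin α * sin β₀)) ∧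
        ∀ s ∈ I, γ s 0 = x₀ ∧ DifferentiableAt ℝ (fun t => γ t 1) s ∧
          deriv (fun t => γ t 1) s ^ 2 = (1 + m * (x₀ ^ 2 + γ s 1 ^ 2)) ^ 2 * sin α ^ 2) ∨
     (sin β₀ = 0 ∧ ∃ y₀ : ℝ, y₀ = (ζ + ℓ * cos α) / (2 * m * sin α * cos β₀) ∧
        ∀ s ∈ I, γ s 1 = y₀ ∧ DifferentiableAt ℝ (fun t => γ t 0) s ∧
          deriv (fun t => γ t 0) s ^ 2 = (1 + m * (γ s 0 ^ 2 + y₀ ^ 2)) ^ 2 * sin α ^ 2))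

/-- `γ` is of one of the Types I, II, III on `I`. -/
def IsTypeIToIII (m ℓ α ζ : ℝ) (I : Set ℝ) (γ : ℝ → Vec3) : Prop :=
  IsTypeI m ℓ α ζ I γ ∨ IsTypeII m ℓ α ζ I γ ∨ IsTypeIII m ℓ α ζ I γ

end BCV

end

/-!
The space carries the positively oriented orthonormal frame `E₁ = F ∂x - (ℓ y / 2) ∂z`,
`E₂ = F ∂y + (ℓ x / 2) ∂z`, `E₃ = ∂z`. Once the Christoffel symbols are known (`christoffel_eq`),
everything is expressed in this frame by `frameCoord`: the metric is the Euclidean scalar product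
(`metricInner_eq`), the covariant derivative is the ordinary one plus the cross product with the
angular velocity of the frame (`hasDerivAt_frameCoord`), and the curvature is
`R(X, Y) Z = Z × S (X × Y)` for the endomorphism `S = ℓ² / 4 + (4 m - ℓ²) E₃ ⊗ E₃`
(`frameCoord_curvature`).

Along a helix, `∇_T^(k+2) T = -(κ² + τ²) ∇_T^k T` for `k ≥ 1`, so all terms of the curvature sum but
the first coincide, and the `r`-tension field reduces to two scalar equations in `κ`, `τ` and the
vertical components `T₃, N₃, B₃` of the Frenet frame (`rTension_eq_zero_iff`). The binormal equation
is `(4 m - ℓ²) N₃ w = 0` with `w` a combination of `B₃` and `T₃`. If `N₃ ≠ 0` at a point, then `w`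
vanishes nearby, and the vanishing of `w` and `w'` is incompatible with the normal equation
(`normal_horizontal`). Hence `N₃ = 0`, the Frenet equations make `T₃ = a` and `B₃` constant,
and `∇_T T = ζ E₃ × T` with `ζ = κ / B₃` constant. This is the first order system `IsConstAngle`.
On its solutions the normal equation is `8⁻¹ P₄(ζ) = 0`, where `a = cos α`
(`rTension_eq_zero_iff_helixQuartic`, `P4_eq`).

The system is integrated explicitly. The horizontal part of `T` is `sin α (cos β, sin β)` for a
differentiable angle `β` (`exists_angle`), and `β' / F` is constant. If the constant is nonzero the
curve is of Type I, otherwise `β` is constant and the curve is of Type II or III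
(`isTypeIToIII_of_isConstAngle`). Reversing a curve changes `(a, ζ)` into `(-a, -ζ)`, which makes
`ζ` positive. Conversely, curves of the three types solve the system. The equation of Type III fixes
`x'` or `y'` only up to sign, so there the constants may be `(-cos α, -ζ)`, or `(cos α, -ζ)` when
`ℓ = 0`, but the quartic takes the same value (`helixQuartic_of_sign`).
-/

noncomputable section

namespace BCV

open scoped Matrix

/-! ### Gradients and the derivatives of the metric -/

/-- `f` is differentiable at `p` with partial derivatives `v 0, v 1, v 2`. -/
def HasGrad (f : Vec3 → ℝ) (v : Vec3) (p : Vec3) : Prop :=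
  HasFDerivAt f (∑ i, v i • ContinuousLinearMap.proj (R := ℝ) (φ := fun _ : Fin 3 => ℝ) i) p

theorem HasGrad.partialDeriv_eq {f : Vec3 → ℝ} {v p : Vec3} (h : HasGrad f v p) (i : Fin 3) :
    partialDeriv i f p = v i := by
  unfold partialDeriv
  rw [HasFDerivAt.fderiv h]
  simp [Pi.single_apply]

theorem HasGrad.congr_grad {f : Vec3 → ℝ} {v w p : Vec3} (h : HasGrad f v p)
    (e : ∀ i, v i = w i) : HasGrad f w p := by
  have : v = w := funext e
  rwa [← this]

theorem hasGrad_const (c : ℝ) (p : Vec3) : HasGrad (fun _ => c) (fun _ => 0) p := by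
  unfold HasGrad
  simpa using hasFDerivAt_const c p

theorem hasGrad_coord (j : Fin 3) (p : Vec3) : HasGrad (fun q => q j) (Pi.single j 1) p := by
  unfold HasGrad
  refine (ContinuousLinearMap.proj (R := ℝ) (φ := fun _ : Fin 3 => ℝ) j).hasFDerivAt.congr_fderiv ?_
  ext1 v
  simp [Pi.single_apply]

theorem HasGrad.add {f g : Vec3 → ℝ} {v w p : Vec3} (hf : HasGrad f v p) (hg : HasGrad g w p) :
    HasGrad (fun q => f q + g q) (fun i => v i + w i) p := by
  unfold HasGrad at *
  refine (hf.fun_add hg).congr_fderiv ?_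
  ext1 v
  simp [add_mul, Finset.sum_add_distrib]

theorem HasGrad.mul {f g : Vec3 → ℝ} {v w p : Vec3} (hf : HasGrad f v p) (hg : HasGrad g w p) :
    HasGrad (fun q => f q * g q) (fun i => f p * w i + g p * v i) p := by
  unfold HasGrad at *
  refine (hf.fun_mul hg).congr_fderiv ?_
  ext1 v
  simp [add_mul, Finset.sum_add_distrib, Finset.mul_sum, mul_assoc]

theorem HasGrad.inv {f : Vec3 → ℝ} {v p : Vec3} (hf : HasGrad f v p) (h0 : f p ≠ 0) :
    HasGrad (fun q => (f q)⁻¹) (fun i => -(f p)⁻¹ ^ 2 * v i) p := by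
  unfold HasGrad at *
  refine ((hasDerivAt_inv h0).comp_hasFDerivAt p hf).congr_fderiv ?_
  ext1 v
  simp [Finset.mul_sum, mul_assoc]

theorem HasGrad.congr_of_eventuallyEq {f g : Vec3 → ℝ} {v p : Vec3} (hf : HasGrad f v p)
    (h : g =ᶠ[nhds p] f) : HasGrad g v p :=
  HasFDerivAt.congr_of_eventuallyEq hf h

theorem hasGrad_conf (m : ℝ) (p : Vec3) :
    HasGrad (conf m) ![2 * m * p 0, 2 * m * p 1, 0] p := by
  have h := (hasGrad_const 1 p).add ((hasGrad_const m p).mul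
    (((hasGrad_coord 0 p).mul (hasGrad_coord 0 p)).add
      ((hasGrad_coord 1 p).mul (hasGrad_coord 1 p))))
  have e : conf m = fun q => 1 + m * (q 0 * q 0 + q 1 * q 1) := by
    funext q; simp [conf, pow_two]
  rw [e]
  refine h.congr_grad fun i => ?_
  fin_cases i <;> simp <;> ring

theorem hasGrad_conf_inv (m : ℝ) {p : Vec3} (hp : conf m p ≠ 0) :
    HasGrad (fun q => (conf m q)⁻¹)
      ![-2 * m * p 0 * (conf m p)⁻¹ ^ 2, -2 * m * p 1 * (conf m p)⁻¹ ^ 2, 0] p := by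
  refine ((hasGrad_conf m p).inv hp).congr_grad fun i => ?_
  fin_cases i <;> simp <;> ring

theorem isOpen_domain (m : ℝ) : IsOpen (domain m) := by
  have : Continuous (conf m) := by unfold conf; fun_prop
  exact isOpen_lt continuous_const this

/-- The components of the metric as polynomials in `x`, `y` and `u = 1 / F`. -/
def metricPoly (ℓ : ℝ) (i j : Fin 3) (x y u : ℝ) : ℝ :=
  ![![u * u * (1 + ℓ ^ 2 / 4 * (y * y)), -(ℓ ^ 2 / 4) * (x * y * (u * u)), ℓ / 2 * (y * u)],
    ![-(ℓ ^ 2 / 4) * (x * y * (u * u)), u * u * (1 + ℓ ^ 2 / 4 * (x * x)), -(ℓ / 2) * (x * u)],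
    ![ℓ / 2 * (y * u), -(ℓ / 2) * (x * u), 1]] i j

/-- The Christoffel symbols `Γᵏᵢⱼ` as polynomials in `x`, `y` and `u = 1 / F`. -/
def christoffelPoly (m ℓ : ℝ) (k i j : Fin 3) (x y u : ℝ) : ℝ :=
  ![![![-2 * m * (x * u), (ℓ ^ 2 / 4 - 2 * m) * (y * u), 0],
      ![(ℓ ^ 2 / 4 - 2 * m) * (y * u), (2 * m - ℓ ^ 2 / 2) * (x * u), ℓ / 2],
      ![0, ℓ / 2, 0]],
    ![![(2 * m - ℓ ^ 2 / 2) * (y * u), (ℓ ^ 2 / 4 - 2 * m) * (x * u), -(ℓ / 2)],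
      ![(ℓ ^ 2 / 4 - 2 * m) * (x * u), -2 * m * (y * u), 0],
      ![-(ℓ / 2), 0, 0]],
    ![![ℓ * (m - ℓ ^ 2 / 4) * (x * y * (u * u)),
        ℓ / 2 * (ℓ ^ 2 / 4 - m) * ((x * x + -1 * (y * y)) * (u * u)), -(ℓ ^ 2 / 4) * (x * u)],
      ![ℓ / 2 * (ℓ ^ 2 / 4 - m) * ((x * x + -1 * (y * y)) * (u * u)),
        -(ℓ * (m - ℓ ^ 2 / 4)) * (x * y * (u * u)), -(ℓ ^ 2 / 4) * (y * u)],
      ![-(ℓ ^ 2 / 4) * (x * u), -(ℓ ^ 2 / 4) * (y * u), 0]]] k i j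

theorem metric_eq_metricPoly (m ℓ : ℝ) (p : Vec3) (i j : Fin 3) :
    metric m ℓ p i j = metricPoly ℓ i j (p 0) (p 1) (conf m p)⁻¹ := by
  fin_cases i <;> fin_cases j <;> norm_num [metric, metricPoly, vertForm, div_eq_mul_inv] <;> ring

/-- The gradient of a component of the metric, as polynomials in `x`, `y` and `u = 1 / F`. -/
def metricGrad (m ℓ : ℝ) (i j : Fin 3) (x y u : ℝ) : Vec3 :=
  ![![![-4 * m * x * u ^ 3 * (1 + ℓ ^ 2 / 4 * y ^ 2),
        -4 * m * y * u ^ 3 * (1 + ℓ ^ 2 / 4 * y ^ 2) + ℓ ^ 2 / 2 * y * u ^ 2, 0],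
      ![-(ℓ ^ 2 / 4) * (y * u ^ 2 - 4 * m * x ^ 2 * y * u ^ 3),
        -(ℓ ^ 2 / 4) * (x * u ^ 2 - 4 * m * x * y ^ 2 * u ^ 3), 0],
      ![-ℓ * m * x * y * u ^ 2, ℓ / 2 * (u - 2 * m * y ^ 2 * u ^ 2), 0]],
    ![![-(ℓ ^ 2 / 4) * (y * u ^ 2 - 4 * m * x ^ 2 * y * u ^ 3),
        -(ℓ ^ 2 / 4) * (x * u ^ 2 - 4 * m * x * y ^ 2 * u ^ 3), 0],
      ![-4 * m * x * u ^ 3 * (1 + ℓ ^ 2 / 4 * x ^ 2) + ℓ ^ 2 / 2 * x * u ^ 2,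
        -4 * m * y * u ^ 3 * (1 + ℓ ^ 2 / 4 * x ^ 2), 0],
      ![-(ℓ / 2) * (u - 2 * m * x ^ 2 * u ^ 2), ℓ * m * x * y * u ^ 2, 0]],
    ![![-ℓ * m * x * y * u ^ 2, ℓ / 2 * (u - 2 * m * y ^ 2 * u ^ 2), 0],
      ![-(ℓ / 2) * (u - 2 * m * x ^ 2 * u ^ 2), ℓ * m * x * y * u ^ 2, 0],
      ![0, 0, 0]]] i j

theorem hasGrad_metric (m ℓ : ℝ) {p : Vec3} (hp : conf m p ≠ 0) (i j : Fin 3) :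
    HasGrad (fun q => metric m ℓ q i j)
      (metricGrad m ℓ i j (p 0) (p 1) (conf m p)⁻¹) p := by
  simp_rw [metric_eq_metricPoly]
  have hu := hasGrad_conf_inv m hp
  have hx := hasGrad_coord 0 p
  have hy := hasGrad_coord 1 p
  fin_cases i <;> fin_cases j <;>
  · simp only [metricPoly, Fin.zero_eta, Fin.mk_one, Fin.reduceFinMk, Fin.isValue, Matrix.cons_val]
    apply HasGrad.congr_grad
    · repeat' first
        | exact hu | exact hx | exact hy | exact hasGrad_const _ _
        | apply HasGrad.add | apply HasGrad.mul
    · intro k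
      fin_cases k <;> simp [metricGrad, -mul_eq_mul_left_iff] <;> ring

/-! ### Christoffel symbols -/

/-- The components of the inverse metric as polynomials in `x`, `y` and `F`. -/
def metricInv (ℓ x y F : ℝ) : Matrix (Fin 3) (Fin 3) ℝ :=
  !![F ^ 2, 0, -(F * ℓ * y / 2); 0, F ^ 2, F * ℓ * x / 2;
    -(F * ℓ * y / 2), F * ℓ * x / 2, 1 + ℓ ^ 2 / 4 * (x ^ 2 + y ^ 2)]

theorem metric_inv (m ℓ : ℝ) {p : Vec3} (hp : conf m p ≠ 0) :
    (metric m ℓ p)⁻¹ = metricInv ℓ (p 0) (p 1) (conf m p) := by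
  apply Matrix.inv_eq_right_inv
  ext i j
  rw [Matrix.mul_apply, Fin.sum_univ_three]
  simp only [metric_eq_metricPoly]
  fin_cases i <;> fin_cases j <;> simp [metricInv, metricPoly] <;> field_simp <;> ring

theorem christoffel_identity (m ℓ : ℝ) {x y F : ℝ} (hF : F = 1 + m * (x ^ 2 + y ^ 2))
    (h0 : F ≠ 0) (k i j : Fin 3) :
    (1 / 2) * ∑ l, metricInv ℓ x y F k l *
      (metricGrad m ℓ j l x y F⁻¹ i + metricGrad m ℓ i l x y F⁻¹ j - metricGrad m ℓ i j x y F⁻¹ l)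
      = christoffelPoly m ℓ k i j x y F⁻¹ := by
  rw [Fin.sum_univ_three]
  fin_cases k <;> fin_cases i <;> fin_cases j <;>
    simp [metricInv, metricGrad, christoffelPoly] <;> field_simp <;> subst hF <;> ring

theorem christoffel_eq (m ℓ : ℝ) {p : Vec3} (hp : conf m p ≠ 0) (k i j : Fin 3) :
    christoffel (metric m ℓ) k i j p
      = christoffelPoly m ℓ k i j (p 0) (p 1) (conf m p)⁻¹ := by
  unfold christoffel
  simp only [metric_inv m ℓ hp, (hasGrad_metric m ℓ hp _ _).partialDeriv_eq]
  exact christoffel_identity m ℓ rfl hp k i j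

theorem HasGrad.const_mul {f : Vec3 → ℝ} {v p : Vec3} (c : ℝ) (hf : HasGrad f v p) :
    HasGrad (fun q => c * f q) (c • v) p :=
  ((hasGrad_const c p).mul hf).congr_grad fun i => by simp

/-- The gradient of `x / F`, with `u = 1 / F`. -/
def gradXU (m x y u : ℝ) : Vec3 := ![u - 2 * m * x ^ 2 * u ^ 2, -(2 * m * x * y * u ^ 2), 0]

/-- The gradient of `y / F`, with `u = 1 / F`. -/
def gradYU (m x y u : ℝ) : Vec3 := ![-(2 * m * x * y * u ^ 2), u - 2 * m * y ^ 2 * u ^ 2, 0]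

/-- The gradient of `x y / F²`, with `u = 1 / F`. -/
def gradXYUU (m x y u : ℝ) : Vec3 :=
  ![y * u ^ 2 - 4 * m * x ^ 2 * y * u ^ 3, x * u ^ 2 - 4 * m * x * y ^ 2 * u ^ 3, 0]

/-- The gradient of `(x² - y²) / F²`, with `u = 1 / F`. -/
def gradQUU (m x y u : ℝ) : Vec3 :=
  ![2 * x * u ^ 2 - 4 * m * x * (x ^ 2 - y ^ 2) * u ^ 3,
    -(2 * y * u ^ 2) - 4 * m * y * (x ^ 2 - y ^ 2) * u ^ 3, 0]

theorem hasGrad_xu (m : ℝ) {p : Vec3} (hp : conf m p ≠ 0) :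
    HasGrad (fun q => q 0 * (conf m q)⁻¹) (gradXU m (p 0) (p 1) (conf m p)⁻¹) p := by
  refine ((hasGrad_coord 0 p).mul (hasGrad_conf_inv m hp)).congr_grad fun a => ?_
  fin_cases a <;> simp [gradXU] <;> ring

theorem hasGrad_yu (m : ℝ) {p : Vec3} (hp : conf m p ≠ 0) :
    HasGrad (fun q => q 1 * (conf m q)⁻¹) (gradYU m (p 0) (p 1) (conf m p)⁻¹) p := by
  refine ((hasGrad_coord 1 p).mul (hasGrad_conf_inv m hp)).congr_grad fun a => ?_
  fin_cases a <;> simp [gradYU] <;> ring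

theorem hasGrad_xyuu (m : ℝ) {p : Vec3} (hp : conf m p ≠ 0) :
    HasGrad (fun q => q 0 * q 1 * ((conf m q)⁻¹ * (conf m q)⁻¹))
      (gradXYUU m (p 0) (p 1) (conf m p)⁻¹) p := by
  have hu := hasGrad_conf_inv m hp
  refine (((hasGrad_coord 0 p).mul (hasGrad_coord 1 p)).mul (hu.mul hu)).congr_grad fun a => ?_
  fin_cases a <;> simp [gradXYUU] <;> ring

theorem hasGrad_quu (m : ℝ) {p : Vec3} (hp : conf m p ≠ 0) :
    HasGrad (fun q => (q 0 * q 0 + -1 * (q 1 * q 1)) * ((conf m q)⁻¹ * (conf m q)⁻¹))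
      (gradQUU m (p 0) (p 1) (conf m p)⁻¹) p := by
  have hu := hasGrad_conf_inv m hp
  have hx := hasGrad_coord 0 p
  have hy := hasGrad_coord 1 p
  refine (((hx.mul hx).add ((hasGrad_const (-1) p).mul (hy.mul hy))).mul
    (hu.mul hu)).congr_grad fun a => ?_
  fin_cases a <;> simp [gradQUU] <;> ring

/-- The gradient of a Christoffel symbol, as polynomials in `x`, `y` and `u = 1 / F`. -/
def christoffelGrad (m ℓ : ℝ) (k i j : Fin 3) (x y u : ℝ) : Vec3 :=
  ![![![(-2 * m) • gradXU m x y u, (ℓ ^ 2 / 4 - 2 * m) • gradYU m x y u, fun _ => 0],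
      ![(ℓ ^ 2 / 4 - 2 * m) • gradYU m x y u, (2 * m - ℓ ^ 2 / 2) • gradXU m x y u, fun _ => 0],
      ![fun _ => 0, fun _ => 0, fun _ => 0]],
    ![![(2 * m - ℓ ^ 2 / 2) • gradYU m x y u, (ℓ ^ 2 / 4 - 2 * m) • gradXU m x y u, fun _ => 0],
      ![(ℓ ^ 2 / 4 - 2 * m) • gradXU m x y u, (-2 * m) • gradYU m x y u, fun _ => 0],
      ![fun _ => 0, fun _ => 0, fun _ => 0]],
    ![![(ℓ * (m - ℓ ^ 2 / 4)) • gradXYUU m x y u, (ℓ / 2 * (ℓ ^ 2 / 4 - m)) • gradQUU m x y u,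
        (-(ℓ ^ 2 / 4)) • gradXU m x y u],
      ![(ℓ / 2 * (ℓ ^ 2 / 4 - m)) • gradQUU m x y u, (-(ℓ * (m - ℓ ^ 2 / 4))) • gradXYUU m x y u,
        (-(ℓ ^ 2 / 4)) • gradYU m x y u],
      ![(-(ℓ ^ 2 / 4)) • gradXU m x y u, (-(ℓ ^ 2 / 4)) • gradYU m x y u, fun _ => 0]]] k i j

theorem hasGrad_christoffelPoly (m ℓ : ℝ) {p : Vec3} (hp : conf m p ≠ 0) (k i j : Fin 3) :
    HasGrad (fun q => christoffelPoly m ℓ k i j (q 0) (q 1) (conf m q)⁻¹)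
      (christoffelGrad m ℓ k i j (p 0) (p 1) (conf m p)⁻¹) p := by
  fin_cases k <;> fin_cases i <;> fin_cases j <;>
  · simp only [christoffelPoly, christoffelGrad, Fin.zero_eta, Fin.mk_one, Fin.reduceFinMk,
      Fin.isValue, Matrix.cons_val]
    first
      | exact hasGrad_const _ _
      | exact (hasGrad_xu m hp).const_mul _
      | exact (hasGrad_yu m hp).const_mul _
      | exact (hasGrad_xyuu m hp).const_mul _
      | exact (hasGrad_quu m hp).const_mul _

theorem hasGrad_christoffel (m ℓ : ℝ) {p : Vec3} (hp : 0 < conf m p) (k i j : Fin 3) :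
    HasGrad (christoffel (metric m ℓ) k i j)
      (christoffelGrad m ℓ k i j (p 0) (p 1) (conf m p)⁻¹) p := by
  refine (hasGrad_christoffelPoly m ℓ hp.ne' k i j).congr_of_eventuallyEq ?_
  filter_upwards [(isOpen_domain m).mem_nhds hp] with q hq
  exact christoffel_eq m ℓ (ne_of_gt hq) k i j

/-! ### The orthonormal frame and the curvature -/

/-- The components of the tangent vector `v` at `p` in the positively oriented orthonormal frame
`E₁ = F ∂x - (ℓ y / 2) ∂z`, `E₂ = F ∂y + (ℓ x / 2) ∂z`, `E₃ = ∂z`. -/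
def frameCoord (m ℓ : ℝ) (p v : Vec3) : Vec3 :=
  ![(conf m p)⁻¹ * v 0, (conf m p)⁻¹ * v 1,
    ℓ / 2 * (conf m p)⁻¹ * (p 1 * v 0 - p 0 * v 1) + v 2]

theorem frameCoord_add (m ℓ : ℝ) (p v w : Vec3) :
    frameCoord m ℓ p (v + w) = frameCoord m ℓ p v + frameCoord m ℓ p w := by
  ext i; fin_cases i <;> simp [frameCoord] <;> ring

theorem frameCoord_smul (m ℓ : ℝ) (p : Vec3) (c : ℝ) (v : Vec3) :
    frameCoord m ℓ p (c • v) = c • frameCoord m ℓ p v := by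
  ext i; fin_cases i <;> simp [frameCoord] <;> ring

/-- `frameCoord` as a linear map. -/
def frameCoordₗ (m ℓ : ℝ) (p : Vec3) : Vec3 →ₗ[ℝ] Vec3 where
  toFun := frameCoord m ℓ p
  map_add' := frameCoord_add m ℓ p
  map_smul' := frameCoord_smul m ℓ p

theorem frameCoord_eq_zero {m ℓ : ℝ} {p : Vec3} (hp : conf m p ≠ 0) {v : Vec3} :
    frameCoord m ℓ p v = 0 ↔ v = 0 := by
  constructor
  · intro h
    have h0 := congrFun h 0
    have h1 := congrFun h 1
    have h2 := congrFun h 2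
    simp [frameCoord, hp] at h0 h1 h2
    ext i
    fin_cases i <;> simp_all
  · rintro rfl
    ext i; fin_cases i <;> simp [frameCoord]

theorem metricInner_eq (m ℓ : ℝ) (p v w : Vec3) :
    metricInner (metric m ℓ) p v w = frameCoord m ℓ p v ⬝ᵥ frameCoord m ℓ p w := by
  simp [metricInner, Fin.sum_univ_three, metric_eq_metricPoly, metricPoly, frameCoord,
    dotProduct]
  ring

theorem det_frameCoord (m ℓ : ℝ) (p u v w : Vec3) :
    (Matrix.of ![frameCoord m ℓ p u, frameCoord m ℓ p v, frameCoord m ℓ p w]).det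
      = (conf m p)⁻¹ ^ 2 * (Matrix.of ![u, v, w]).det := by
  simp [Matrix.det_fin_three, frameCoord]
  ring

/-- The curvature operator of the space in frame components. With `S` the endomorphism of
eigenvalue `ℓ² / 4` on `E₁, E₂` and `4 m - 3 ℓ² / 4` on `E₃`, it is `R(X, Y) Z = Z × S (X × Y)`. -/
def frameCurv (m ℓ : ℝ) (X Y Z : Vec3) : Vec3 :=
  Z ⨯₃ ((ℓ ^ 2 / 4) • (X ⨯₃ Y) + ((4 * m - ℓ ^ 2) * (X ⨯₃ Y) 2) • ![0, 0, 1])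

/-- The components `Rˡᵢⱼₖ` of the curvature tensor in terms of `x`, `y` and `u = 1 / F`. -/
def riemannPoly (m ℓ : ℝ) (i j k : Fin 3) (x y u : ℝ) : Vec3 := fun l =>
  christoffelGrad m ℓ l j k x y u i - christoffelGrad m ℓ l i k x y u j
    + ∑ a, (christoffelPoly m ℓ l i a x y u * christoffelPoly m ℓ a j k x y u
      - christoffelPoly m ℓ l j a x y u * christoffelPoly m ℓ a i k x y u)

theorem curvature_eq (m ℓ : ℝ) {p : Vec3} (hp : 0 < conf m p) (X Y Z : Vec3) :
    curvature (metric m ℓ) p X Y Z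
      = ∑ i, ∑ j, ∑ k, (X i * Y j * Z k) • riemannPoly m ℓ i j k (p 0) (p 1) (conf m p)⁻¹ := by
  ext l
  simp only [curvature, (hasGrad_christoffel m ℓ hp _ _ _).partialDeriv_eq,
    christoffel_eq m ℓ hp.ne', Finset.sum_apply, Pi.smul_apply, smul_eq_mul, riemannPoly]

theorem riemannPoly_swap (m ℓ : ℝ) (i j k : Fin 3) (x y u : ℝ) :
    riemannPoly m ℓ j i k x y u = -riemannPoly m ℓ i j k x y u := by
  ext l
  simp only [riemannPoly, Pi.neg_apply, Finset.sum_sub_distrib]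
  ring

theorem frameCurv_swap (m ℓ : ℝ) (X Y Z : Vec3) :
    frameCurv m ℓ Y X Z = -frameCurv m ℓ X Y Z := by
  ext l
  fin_cases l <;> simp [frameCurv, cross_apply] <;> ring

set_option maxHeartbeats 2000000 in
/-- The curvature on coordinate vectors, checked on all 27 components with `i < j`. -/
theorem frameCoord_riemannPoly_of_lt (m ℓ : ℝ) {p : Vec3} (hp : 0 < conf m p) {i j : Fin 3}
    (hij : i < j) (k : Fin 3) :
    frameCoord m ℓ p (riemannPoly m ℓ i j k (p 0) (p 1) (conf m p)⁻¹)
      = frameCurv m ℓ (frameCoord m ℓ p (Pi.single i 1)) (frameCoord m ℓ p (Pi.single j 1))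
          (frameCoord m ℓ p (Pi.single k 1)) := by
  obtain ⟨x, hx⟩ : ∃ x, x = p 0 := ⟨_, rfl⟩
  obtain ⟨y, hy⟩ : ∃ y, y = p 1 := ⟨_, rfl⟩
  obtain ⟨F, hF⟩ : ∃ F, F = conf m p := ⟨_, rfl⟩
  have h0 : F ≠ 0 := hF ▸ hp.ne'
  have hF' : F = 1 + m * (x ^ 2 + y ^ 2) := by rw [hF, hx, hy, conf]
  ext l
  simp only [frameCoord, ← hx, ← hy, ← hF]
  clear hF hx hy hp
  fin_cases i <;> fin_cases j <;> first
    | exact absurd hij (by decide)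
    | fin_cases k <;> fin_cases l <;>
      simp [frameCurv, riemannPoly, christoffelGrad, christoffelPoly, Fin.sum_univ_three,
        gradXU, gradYU, gradXYUU, gradQUU, cross_apply, h0, -mul_eq_mul_left_iff] <;>
      field_simp <;> subst hF' <;> ring

theorem frameCoord_riemannPoly (m ℓ : ℝ) {p : Vec3} (hp : 0 < conf m p) (i j k : Fin 3) :
    frameCoord m ℓ p (riemannPoly m ℓ i j k (p 0) (p 1) (conf m p)⁻¹)
      = frameCurv m ℓ (frameCoord m ℓ p (Pi.single i 1)) (frameCoord m ℓ p (Pi.single j 1))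
          (frameCoord m ℓ p (Pi.single k 1)) := by
  rcases lt_trichotomy i j with h | rfl | h
  · exact frameCoord_riemannPoly_of_lt m ℓ hp h k
  · have h1 := self_eq_neg.1 (riemannPoly_swap m ℓ i i k (p 0) (p 1) (conf m p)⁻¹)
    rw [h1, self_eq_neg.1 (frameCurv_swap m ℓ _ _ _), (frameCoord_eq_zero hp.ne').2 rfl]
  · rw [riemannPoly_swap, frameCurv_swap, ← frameCoord_riemannPoly_of_lt m ℓ hp h k]
    exact (frameCoordₗ m ℓ p).map_neg _

theorem frameCoord_curvature (m ℓ : ℝ) {p : Vec3} (hp : 0 < conf m p) (X Y Z : Vec3) :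
    frameCoord m ℓ p (curvature (metric m ℓ) p X Y Z)
      = frameCurv m ℓ (frameCoord m ℓ p X) (frameCoord m ℓ p Y) (frameCoord m ℓ p Z) := by
  have h : frameCoord m ℓ p (curvature (metric m ℓ) p X Y Z)
      = ∑ i, ∑ j, ∑ k, (X i * Y j * Z k) • frameCurv m ℓ (frameCoord m ℓ p (Pi.single i 1))
          (frameCoord m ℓ p (Pi.single j 1)) (frameCoord m ℓ p (Pi.single k 1)) := by
    rw [curvature_eq m ℓ hp]
    simp only [← frameCoord_riemannPoly m ℓ hp]
    exact (map_sum (frameCoordₗ m ℓ p) _ _).trans <| Finset.sum_congr rfl fun i _ =>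
      (map_sum (frameCoordₗ m ℓ p) _ _).trans <| Finset.sum_congr rfl fun j _ =>
        (map_sum (frameCoordₗ m ℓ p) _ _).trans <| Finset.sum_congr rfl fun k _ =>
          (frameCoordₗ m ℓ p).map_smul _ _
  rw [h]
  ext l
  simp only [Fin.sum_univ_three]
  fin_cases l <;> simp [frameCurv, frameCoord, cross_apply] <;> ring

/-- The angular velocity of the frame `E₁, E₂, E₃` in the direction with frame components `X`:
`∇_X Eₐ = w × Eₐ` for `w = frameVel m ℓ p X`. -/
def frameVel (m ℓ : ℝ) (p X : Vec3) : Vec3 :=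
  ![ℓ / 2 * X 0, ℓ / 2 * X 1, 2 * m * (p 1 * X 0 - p 0 * X 1) - ℓ / 2 * X 2]

theorem hasDerivAt_frameCoord (m ℓ : ℝ) {γ V : ℝ → Vec3} {s : ℝ} (hp : 0 < conf m (γ s))
    (hγ : ∀ i, DifferentiableAt ℝ (fun t => γ t i) s)
    (hV : ∀ i, DifferentiableAt ℝ (fun t => V t i) s) :
    HasDerivAt (fun t => frameCoord m ℓ (γ t) (V t))
      (frameCoord m ℓ (γ s) (covDeriv (metric m ℓ) γ V s)
        - frameVel m ℓ (γ s) (frameCoord m ℓ (γ s) (tangent γ s)) ⨯₃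
          frameCoord m ℓ (γ s) (V s)) s := by
  have g0 := (hγ 0).hasDerivAt
  have g1 := (hγ 1).hasDerivAt
  have g2 := (hγ 2).hasDerivAt
  have v0 := (hV 0).hasDerivAt
  have v1 := (hV 1).hasDerivAt
  have v2 := (hV 2).hasDerivAt
  have hF : HasDerivAt (fun t => conf m (γ t)) (m * (2 * γ s 0 * deriv (fun t => γ t 0) s
      + 2 * γ s 1 * deriv (fun t => γ t 1) s)) s := by
    have := (((g0.pow 2).add (g1.pow 2)).const_mul m).const_add 1
    refine this.congr_deriv ?_
    norm_num
  have hu := hF.inv hp.ne'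
  obtain ⟨x, hx⟩ : ∃ x, x = γ s 0 := ⟨_, rfl⟩
  obtain ⟨y, hy⟩ : ∃ y, y = γ s 1 := ⟨_, rfl⟩
  obtain ⟨F, hF⟩ : ∃ F, F = conf m (γ s) := ⟨_, rfl⟩
  have h0 : F ≠ 0 := hF ▸ hp.ne'
  have hF' : F = 1 + m * (x ^ 2 + y ^ 2) := by rw [hF, hx, hy, conf]
  rw [hasDerivAt_pi]
  intro l
  fin_cases l
  · refine (hu.mul v0).congr_deriv ?_
    simp [frameCoord, covDeriv, frameVel, tangent, Fin.sum_univ_three, christoffel_eq m ℓ hp.ne',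
      christoffelPoly, cross_apply, ← hx, ← hy, ← hF]
    field_simp
    ring
  · refine (hu.mul v1).congr_deriv ?_
    simp [frameCoord, covDeriv, frameVel, tangent, Fin.sum_univ_three, christoffel_eq m ℓ hp.ne',
      christoffelPoly, cross_apply, ← hx, ← hy, ← hF]
    field_simp
    ring
  · refine (((hu.const_mul (ℓ / 2)).mul ((g1.mul v0).sub (g0.mul v1))).add v2).congr_deriv ?_
    simp [frameCoord, covDeriv, frameVel, tangent, Fin.sum_univ_three, christoffel_eq m ℓ hp.ne',
      christoffelPoly, cross_apply, ← hx, ← hy, ← hF]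
    field_simp
    subst hF'
    ring

/-! ### Orthonormal bases of Euclidean space -/

theorem frameCurv_add_smul_right (m ℓ a b : ℝ) (X Y Y' Z : Vec3) :
    frameCurv m ℓ X (a • Y + b • Y') Z = a • frameCurv m ℓ X Y Z + b • frameCurv m ℓ X Y' Z := by
  ext l
  fin_cases l <;> simp [frameCurv, cross_apply] <;> ring

theorem frameCurv_smul_left (m ℓ a : ℝ) (X Y Z : Vec3) :
    frameCurv m ℓ (a • X) Y Z = a • frameCurv m ℓ X Y Z := by
  ext l
  fin_cases l <;> simp [frameCurv, cross_apply] <;> ring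

theorem frameCurv_smul_right (m ℓ a : ℝ) (X Y Z : Vec3) :
    frameCurv m ℓ X (a • Y) Z = a • frameCurv m ℓ X Y Z := by
  ext l
  fin_cases l <;> simp [frameCurv, cross_apply] <;> ring

/-- `t, n, b` is a positively oriented orthonormal basis of Euclidean space. -/
structure IsOrthoFrame (t n b : Vec3) : Prop where
  tt : t ⬝ᵥ t = 1
  nn : n ⬝ᵥ n = 1
  tn : t ⬝ᵥ n = 0
  cross : b = t ⨯₃ n

theorem isOrthoFrame_of_det_pos {t n b : Vec3} (tt : t ⬝ᵥ t = 1) (nn : n ⬝ᵥ n = 1)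
    (bb : b ⬝ᵥ b = 1) (tn : t ⬝ᵥ n = 0) (tb : t ⬝ᵥ b = 0) (nb : n ⬝ᵥ b = 0)
    (hdet : 0 < (Matrix.of ![t, n, b]).det) : IsOrthoFrame t n b := by
  refine ⟨tt, nn, tn, ?_⟩
  have nt : n ⬝ᵥ t = 0 := by rw [dotProduct_comm, tn]
  have bt : b ⬝ᵥ t = 0 := by rw [dotProduct_comm, tb]
  have bn : b ⬝ᵥ n = 0 := by rw [dotProduct_comm, nb]
  have hAA : Matrix.of ![t, n, b] * (Matrix.of ![t, n, b])ᵀ = 1 := by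
    ext i j
    change ![t, n, b] i ⬝ᵥ ![t, n, b] j = _
    fin_cases i <;> fin_cases j <;> simp [tt, nn, bb, tn, tb, nb, nt, bt, bn]
  have hd : (Matrix.of ![t, n, b]).det = 1 := by
    have h := congrArg Matrix.det hAA
    rw [Matrix.det_mul, Matrix.det_transpose, Matrix.det_one] at h
    nlinarith
  have hc : b ⬝ᵥ t ⨯₃ n = 1 := by
    rw [← hd, ← triple_product_permutation, ← triple_product_permutation]
    exact triple_product_eq_det t n b
  have h0 : (b - t ⨯₃ n) ⬝ᵥ (b - t ⨯₃ n) = 0 := by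
    rw [sub_dotProduct, dotProduct_sub, dotProduct_sub, dotProduct_comm (t ⨯₃ n) b, hc, bb,
      cross_dot_cross, tt, nn, tn]
    ring
  exact sub_eq_zero.1 (dotProduct_self_eq_zero.1 h0)

namespace IsOrthoFrame

theorem cross_tb {t n b : Vec3} (h : IsOrthoFrame t n b) : t ⨯₃ b = -n := by
  rw [h.cross, cross_cross_eq_smul_sub_smul', h.tn, h.tt]
  simp

theorem cross_nb {t n b : Vec3} (h : IsOrthoFrame t n b) : n ⨯₃ b = t := by
  rw [h.cross, cross_cross_eq_smul_sub_smul', h.nn, h.tn]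
  simp

theorem nb {t n b : Vec3} (h : IsOrthoFrame t n b) : n ⬝ᵥ b = 0 := by
  rw [h.cross]; simp

theorem bb {t n b : Vec3} (h : IsOrthoFrame t n b) : b ⬝ᵥ b = 1 := by
  rw [h.cross, cross_dot_cross, h.tt, h.nn, h.tn]; simp

/-- The expansion of `t × E₃` in the basis. -/
theorem cross_vert {t n b : Vec3} (h : IsOrthoFrame t n b) :
    t ⨯₃ ![0, 0, 1] = n 2 • b - b 2 • n := by
  have h1 : t = n ⨯₃ b := h.cross_nb.symm
  rw [h1]
  ext i
  fin_cases i <;> simp [cross_apply] <;> ring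

/-- The squares of the components of the unit vector `E₃` in the basis add up to `1`. -/
theorem sum_sq_vert {t n b : Vec3} (h : IsOrthoFrame t n b) :
    t 2 ^ 2 + n 2 ^ 2 + b 2 ^ 2 = 1 := by
  have h1 := congrArg (fun v => v ⬝ᵥ v) h.cross_vert
  simp only [cross_dot_cross] at h1
  have h2 := h.nb
  have h3 : b ⬝ᵥ n = 0 := by rw [dotProduct_comm, h2]
  simp only [sub_dotProduct, dotProduct_sub, smul_dotProduct, dotProduct_smul, h.tt, h.nn, h2,
    h3, h.bb] at h1
  simp [dotProduct, Fin.sum_univ_three] at h1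
  linarith

theorem frameCurv_ntt {t n b : Vec3} (h : IsOrthoFrame t n b) (m ℓ : ℝ) :
    frameCurv m ℓ n t t = (ℓ ^ 2 / 4 + (4 * m - ℓ ^ 2) * b 2 ^ 2) • n
      - ((4 * m - ℓ ^ 2) * b 2 * n 2) • b := by
  have e : n ⨯₃ t = -b := by rw [h.cross, cross_anticomm]
  rw [frameCurv, e, map_add, map_smul, map_smul, map_neg, h.cross_tb, h.cross_vert]
  simp only [Pi.neg_apply]
  module

theorem frameCurv_nbt {t n b : Vec3} (h : IsOrthoFrame t n b) (m ℓ : ℝ) :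
    frameCurv m ℓ n b t = ((4 * m - ℓ ^ 2) * t 2) • (n 2 • b - b 2 • n) := by
  rw [frameCurv, h.cross_nb, map_add, map_smul, map_smul, cross_self, h.cross_vert]
  simp

/-- A combination of `n` and `b` vanishes only if its coefficients do. -/
theorem smul_add_smul_eq_zero {t n b : Vec3} (h : IsOrthoFrame t n b) (c d : ℝ) :
    c • n + d • b = 0 ↔ c = 0 ∧ d = 0 := by
  constructor
  · intro h0
    have h1 := congrArg (fun v => n ⬝ᵥ v) h0
    have h2 := congrArg (fun v => v ⬝ᵥ b) h0
    simp [h.nn, h.nb, h.bb] at h1 h2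
    exact ⟨h1, h2⟩
  · rintro ⟨rfl, rfl⟩
    simp

end IsOrthoFrame

/-! ### Iterated covariant derivatives along a helix -/

theorem covDeriv_congr (g : MetricTensor) (γ : ℝ → Vec3) {V W : ℝ → Vec3} {s : ℝ}
    (h : V =ᶠ[nhds s] W) : covDeriv g γ V s = covDeriv g γ W s := by
  ext k
  have h1 : (fun t => V t k) =ᶠ[nhds s] fun t => W t k := h.mono fun t ht => by simp only [ht]
  simp only [covDeriv, h1.deriv_eq, h.self_of_nhds]

theorem covDeriv_smul (g : MetricTensor) (γ V : ℝ → Vec3) (c s : ℝ) :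
    covDeriv g γ (fun t => c • V t) s = c • covDeriv g γ V s := by
  ext k
  simp only [covDeriv, Pi.smul_apply, smul_eq_mul, deriv_const_mul_field, mul_add,
    Finset.mul_sum]
  congr 1
  refine Finset.sum_congr rfl fun i _ => Finset.sum_congr rfl fun j _ => ?_
  ring

theorem covDeriv_add (g : MetricTensor) (γ : ℝ → Vec3) {V W : ℝ → Vec3} {s : ℝ}
    (hV : ∀ i, DifferentiableAt ℝ (fun t => V t i) s)
    (hW : ∀ i, DifferentiableAt ℝ (fun t => W t i) s) :
    covDeriv g γ (fun t => V t + W t) s = covDeriv g γ V s + covDeriv g γ W s := by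
  ext k
  simp only [covDeriv, Pi.add_apply, deriv_fun_add (hV k) (hW k), mul_add,
    Finset.sum_add_distrib]
  ring

theorem differentiableAt_coord {I : Set ℝ} (hI : IsOpen I) {V : ℝ → Vec3}
    (hV : ContDiffOn ℝ (⊤ : ℕ∞) V I) {s : ℝ} (hs : s ∈ I) (i : Fin 3) :
    DifferentiableAt ℝ (fun t => V t i) s :=
  differentiableAt_pi.1 ((hV.contDiffAt (hI.mem_nhds hs)).differentiableAt (by simp)) i

theorem contDiffOn_tangent {I : Set ℝ} (hI : IsOpen I) {γ : ℝ → Vec3}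
    (hγ : ContDiffOn ℝ (⊤ : ℕ∞) γ I) : ContDiffOn ℝ (⊤ : ℕ∞) (tangent γ) I := by
  rw [contDiffOn_pi] at hγ ⊢
  intro i
  exact (hγ i).deriv_of_isOpen hI (by simp)

namespace IsFrenetCurve3

/-- Along a helix `∇_T^(k+2) T = -(κ² + τ²) ∇_T^k T` for `k ≥ 1`. -/
theorem iterCovTangent_eq {g : MetricTensor} {U : Set Vec3} {I : Set ℝ} {γ N B : ℝ → Vec3}
    {κ τ : ℝ} (h : IsFrenetCurve3 g U I γ N B (fun _ => κ) (fun _ => τ)) (hI : IsOpen I)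
    (j : ℕ) : ∀ s ∈ I,
      iterCovTangent g γ (2 * j + 1) s = ((-(κ ^ 2 + τ ^ 2)) ^ j * κ) • N s ∧
      iterCovTangent g γ (2 * j + 2) s
        = (-(κ ^ 2 + τ ^ 2)) ^ j • (-κ ^ 2 • tangent γ s + (κ * τ) • B s) := by
  have succ : ∀ k s, iterCovTangent g γ (k + 1) s = covDeriv g γ (iterCovTangent g γ k) s := by
    intro k s
    rw [iterCovTangent, Function.iterate_succ_apply']
    rfl
  have even_of_odd : ∀ j, (∀ s ∈ I, iterCovTangent g γ (2 * j + 1) s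
      = ((-(κ ^ 2 + τ ^ 2)) ^ j * κ) • N s) → ∀ s ∈ I, iterCovTangent g γ (2 * j + 2) s
        = (-(κ ^ 2 + τ ^ 2)) ^ j • (-κ ^ 2 • tangent γ s + (κ * τ) • B s) := by
    intro j hj s hs
    rw [succ, covDeriv_congr g γ (Filter.eventuallyEq_of_mem (hI.mem_nhds hs) hj),
      covDeriv_smul, h.deriv_N s hs]
    module
  induction j with
  | zero =>
    have h1 : ∀ s ∈ I, iterCovTangent g γ (2 * 0 + 1) s = ((-(κ ^ 2 + τ ^ 2)) ^ 0 * κ) • N s := by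
      intro s hs
      rw [succ]
      simpa [iterCovTangent] using h.deriv_T s hs
    exact fun s hs => ⟨h1 s hs, even_of_odd 0 h1 s hs⟩
  | succ j ih =>
    have h1 : ∀ s ∈ I, iterCovTangent g γ (2 * (j + 1) + 1) s
        = ((-(κ ^ 2 + τ ^ 2)) ^ (j + 1) * κ) • N s := by
      intro s hs
      have hT := differentiableAt_coord hI (contDiffOn_tangent hI h.smooth) hs
      have hB := differentiableAt_coord hI h.smooth_B hs
      rw [show 2 * (j + 1) + 1 = (2 * j + 2) + 1 by ring, succ,
        covDeriv_congr g γ (Filter.eventuallyEq_of_mem (hI.mem_nhds hs) fun s hs => (ih s hs).2),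
        covDeriv_smul,
        covDeriv_add g γ (V := fun t => -κ ^ 2 • tangent γ t) (W := fun t => (κ * τ) • B t)
          (fun i => (hT i).const_mul _) (fun i => (hB i).const_mul _),
        covDeriv_smul, covDeriv_smul, h.deriv_T s hs, h.deriv_B s hs]
      module
    exact fun s hs => ⟨h1 s hs, even_of_odd (j + 1) h1 s hs⟩

end IsFrenetCurve3

/-! ### The tension field of a helix -/

namespace IsFrenetCurve3

theorem conf_pos {g : MetricTensor} {m : ℝ} {I : Set ℝ} {γ N B : ℝ → Vec3} {k₁ k₂ : ℝ → ℝ}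
    (h : IsFrenetCurve3 g (domain m) I γ N B k₁ k₂) {s : ℝ} (hs : s ∈ I) : 0 < conf m (γ s) :=
  h.mapsTo s hs

theorem isOrthoFrame {m ℓ : ℝ} {I : Set ℝ} {γ N B : ℝ → Vec3} {k₁ k₂ : ℝ → ℝ}
    (h : IsFrenetCurve3 (metric m ℓ) (domain m) I γ N B k₁ k₂) {s : ℝ} (hs : s ∈ I) :
    IsOrthoFrame (frameCoord m ℓ (γ s) (tangent γ s)) (frameCoord m ℓ (γ s) (N s))
      (frameCoord m ℓ (γ s) (B s)) := by
  apply isOrthoFrame_of_det_pos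
  · rw [← metricInner_eq]; exact h.inner_TT s hs
  · rw [← metricInner_eq]; exact h.inner_NN s hs
  · rw [← metricInner_eq]; exact h.inner_BB s hs
  · rw [← metricInner_eq]; exact h.inner_TN s hs
  · rw [← metricInner_eq]; exact h.inner_TB s hs
  · rw [← metricInner_eq]; exact h.inner_NB s hs
  · rw [det_frameCoord]
    have := h.conf_pos hs
    exact mul_pos (by positivity) (h.oriented s hs)

/-- The terms `l ≥ 1` of the curvature sum in the `r`-tension field are all equal. -/
theorem frameCoord_curvature_iterCovTangent {m ℓ : ℝ} {I : Set ℝ} {γ N B : ℝ → Vec3} {κ τ : ℝ}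
    (h : IsFrenetCurve3 (metric m ℓ) (domain m) I γ N B (fun _ => κ) (fun _ => τ))
    (hI : IsOpen I) {n j : ℕ} (hj : j < n) {s : ℝ} (hs : s ∈ I) :
    (-1 : ℝ) ^ (j + 1) • frameCoord m ℓ (γ s) (curvature (metric m ℓ) (γ s)
        (iterCovTangent (metric m ℓ) γ (2 * n - j) s)
        (iterCovTangent (metric m ℓ) γ (j + 1) s) (tangent γ s))
      = ((-(κ ^ 2 + τ ^ 2)) ^ (n - 1) * κ ^ 2) •
        (τ • frameCurv m ℓ (frameCoord m ℓ (γ s) (N s)) (frameCoord m ℓ (γ s) (B s))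
            (frameCoord m ℓ (γ s) (tangent γ s))
          - κ • frameCurv m ℓ (frameCoord m ℓ (γ s) (N s)) (frameCoord m ℓ (γ s) (tangent γ s))
            (frameCoord m ℓ (γ s) (tangent γ s))) := by
  rw [frameCoord_curvature m ℓ (h.conf_pos hs)]
  rcases Nat.even_or_odd' j with ⟨i, rfl | rfl⟩
  · obtain ⟨e, rfl⟩ : ∃ e, n = i + e + 1 := ⟨n - i - 1, by omega⟩
    rw [show 2 * (i + e + 1) - 2 * i = 2 * e + 2 by omega, show i + e + 1 - 1 = i + e by omega,
      (h.iterCovTangent_eq hI e s hs).2, (h.iterCovTangent_eq hI i s hs).1]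
    simp only [frameCoord_smul, frameCoord_add]
    rw [frameCurv_swap, frameCurv_smul_right, frameCurv_smul_left, frameCurv_add_smul_right,
      Odd.neg_one_pow ⟨i, rfl⟩]
    module
  · obtain ⟨e, rfl⟩ : ∃ e, n = i + e + 1 := ⟨n - i - 1, by omega⟩
    rw [show 2 * (i + e + 1) - (2 * i + 1) = 2 * e + 1 by omega,
      show i + e + 1 - 1 = i + e by omega, show 2 * i + 1 + 1 = 2 * i + 2 by ring,
      (h.iterCovTangent_eq hI i s hs).2, (h.iterCovTangent_eq hI e s hs).1]
    simp only [frameCoord_smul, frameCoord_add]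
    rw [frameCurv_smul_right, frameCurv_smul_left, frameCurv_add_smul_right,
      Even.neg_one_pow ⟨i + 1, by ring⟩]
    module

/-- The `r`-tension field of a helix, `r = n + 2`. The factor `-(κ² + τ²)` on the left avoids the
exponent `n - 1` on the right. -/
theorem frameCoord_rTension {m ℓ : ℝ} {I : Set ℝ} {γ N B : ℝ → Vec3} {κ τ : ℝ}
    (h : IsFrenetCurve3 (metric m ℓ) (domain m) I γ N B (fun _ => κ) (fun _ => τ))
    (hI : IsOpen I) (n : ℕ) {s : ℝ} (hs : s ∈ I) :
    (-(κ ^ 2 + τ ^ 2)) • frameCoord m ℓ (γ s) (rTension (metric m ℓ) (n + 2) γ s)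
      = ((-(κ ^ 2 + τ ^ 2)) ^ n * κ) •
        ((-(κ ^ 2 + τ ^ 2)) ^ 2 • frameCoord m ℓ (γ s) (N s)
          + (-(κ ^ 2 + τ ^ 2) - n * κ ^ 2) • frameCurv m ℓ (frameCoord m ℓ (γ s) (N s))
            (frameCoord m ℓ (γ s) (tangent γ s)) (frameCoord m ℓ (γ s) (tangent γ s))
          + (n * κ * τ) • frameCurv m ℓ (frameCoord m ℓ (γ s) (N s)) (frameCoord m ℓ (γ s) (B s))
            (frameCoord m ℓ (γ s) (tangent γ s))) := by
  have hsum : frameCoord m ℓ (γ s) (rTension (metric m ℓ) (n + 2) γ s)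
      = frameCoord m ℓ (γ s) (iterCovTangent (metric m ℓ) γ (2 * (n + 1) + 1) s)
        + ((∑ j ∈ Finset.range n, (-1 : ℝ) ^ (j + 1) • frameCoord m ℓ (γ s)
            (curvature (metric m ℓ) (γ s) (iterCovTangent (metric m ℓ) γ (2 * n - j) s)
              (iterCovTangent (metric m ℓ) γ (j + 1) s) (tangent γ s)))
          + frameCoord m ℓ (γ s) (curvature (metric m ℓ) (γ s)
            (iterCovTangent (metric m ℓ) γ (2 * n + 1) s) (tangent γ s) (tangent γ s))) := by
    rw [rTension, frameCoord_add, show n + 2 - 1 = n + 1 by omega, Finset.sum_range_succ',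
      frameCoord_add, pow_zero, one_smul]
    congr 2
    refine (map_sum (frameCoordₗ m ℓ (γ s)) _ _).trans (Finset.sum_congr rfl fun j _ => ?_)
    rw [show 2 * (n + 2) - 3 - (j + 1) = 2 * n - j by omega]
    exact (frameCoordₗ m ℓ (γ s)).map_smul _ _
  rw [hsum, Finset.sum_congr rfl fun j hj =>
    h.frameCoord_curvature_iterCovTangent hI (Finset.mem_range.1 hj) hs, Finset.sum_const,
    Finset.card_range, frameCoord_curvature m ℓ (h.conf_pos hs),
    (h.iterCovTangent_eq hI n s hs).1, (h.iterCovTangent_eq hI (n + 1) s hs).1,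
    frameCoord_smul, frameCoord_smul, frameCurv_smul_left]
  rcases n with _ | n
  · simp
    module
  · rw [show n + 1 - 1 = n by omega, ← Nat.cast_smul_eq_nsmul ℝ]
    push_cast
    module

theorem sq_add_sq_pos {g : MetricTensor} {U : Set Vec3} {I : Set ℝ} {γ N B : ℝ → Vec3} {κ τ : ℝ}
    (h : IsFrenetCurve3 g U I γ N B (fun _ => κ) (fun _ => τ)) {s : ℝ} (hs : s ∈ I) :
    0 < κ ^ 2 + τ ^ 2 := by
  have hκ : 0 < κ := h.k₁_pos s hs
  positivity

/-- The `r`-tension field of a helix, `r = n + 2`, vanishes at a point if and only if its normal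
and binormal components do. -/
theorem rTension_eq_zero_iff {m ℓ : ℝ} {I : Set ℝ} {γ N B : ℝ → Vec3} {κ τ : ℝ}
    (h : IsFrenetCurve3 (metric m ℓ) (domain m) I γ N B (fun _ => κ) (fun _ => τ))
    (hI : IsOpen I) (n : ℕ) {s : ℝ} (hs : s ∈ I) :
    rTension (metric m ℓ) (n + 2) γ s = 0 ↔
      (κ ^ 2 + τ ^ 2) ^ 2 - (κ ^ 2 + τ ^ 2 + n * κ ^ 2) *
          (ℓ ^ 2 / 4 + (4 * m - ℓ ^ 2) * frameCoord m ℓ (γ s) (B s) 2 ^ 2)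
        - n * κ * τ * ((4 * m - ℓ ^ 2) * frameCoord m ℓ (γ s) (tangent γ s) 2
          * frameCoord m ℓ (γ s) (B s) 2) = 0 ∧
      (4 * m - ℓ ^ 2) * frameCoord m ℓ (γ s) (N s) 2 *
        ((κ ^ 2 + τ ^ 2 + n * κ ^ 2) * frameCoord m ℓ (γ s) (B s) 2
          + n * κ * τ * frameCoord m ℓ (γ s) (tangent γ s) 2) = 0 := by
  have hκ : 0 < κ := h.k₁_pos s hs
  have hq := h.sq_add_sq_pos hs
  have hO := h.isOrthoFrame hs
  rw [← frameCoord_eq_zero (m := m) (ℓ := ℓ) (h.conf_pos hs).ne',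
    ← smul_eq_zero_iff_right (neg_ne_zero.2 hq.ne'), h.frameCoord_rTension hI n hs,
    smul_eq_zero_iff_right (mul_ne_zero (pow_ne_zero _ (neg_ne_zero.2 hq.ne')) hκ.ne'),
    hO.frameCurv_ntt, hO.frameCurv_nbt, ← hO.smul_add_smul_eq_zero]
  refine Eq.congr ?_ rfl
  module

end IsFrenetCurve3

/-! ### Helices of constant angle -/

/-- The quartic that governs `r`-harmonicity, `r = n + 2`, in terms of `a = cos α`. -/
def helixQuartic (m ℓ n a ζ : ℝ) : ℝ :=
  (ζ ^ 2 + ℓ * a * ζ + ℓ ^ 2 / 4) ^ 2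
    - ℓ ^ 2 / 4 * (ζ ^ 2 + ℓ * a * ζ + ℓ ^ 2 / 4 + n * ζ ^ 2 * (1 - a ^ 2))
    - (4 * m - ℓ ^ 2) * (1 - a ^ 2) *
      (ζ ^ 2 + ℓ * a * ζ + ℓ ^ 2 / 4 + n * ζ * (ζ + ℓ / 2 * a))

theorem P4_eq (m ℓ : ℝ) (n : ℕ) (α ζ : ℝ) :
    P4 m ℓ (n + 2) α ζ = 8 * helixQuartic m ℓ n (cos α) ζ := by
  rw [P4, helixQuartic, cos_two_mul, sin_sq]
  push_cast
  ring

theorem helixQuartic_neg (m ℓ n a ζ : ℝ) :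
    helixQuartic m ℓ n (-a) (-ζ) = helixQuartic m ℓ n a ζ := by
  unfold helixQuartic
  ring

/-- A unit speed curve that makes a constant angle `arccos a` with `E₃` and satisfies
`∇_T T = ζ E₃ × T`, written as a first order system: `p` and `q` are the components of `T` along
`E₁` and `E₂`. -/
def IsConstAngle (m ℓ a ζ : ℝ) (I : Set ℝ) (γ : ℝ → Vec3) : Prop :=
  ∃ p q : ℝ → ℝ, ∀ s ∈ I,
    HasDerivAt (fun t => γ t 0) (conf m (γ s) * p s) s ∧
    HasDerivAt (fun t => γ t 1) (conf m (γ s) * q s) s ∧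
    HasDerivAt (fun t => γ t 2) (a + ℓ / 2 * (γ s 0 * q s - γ s 1 * p s)) s ∧
    HasDerivAt p (-(q s * (2 * m * (γ s 0 * q s - γ s 1 * p s) + ℓ * a + ζ))) s ∧
    HasDerivAt q (p s * (2 * m * (γ s 0 * q s - γ s 1 * p s) + ℓ * a + ζ)) s ∧
    p s ^ 2 + q s ^ 2 = 1 - a ^ 2

theorem IsConstAngle.reverse {m ℓ a ζ : ℝ} {I : Set ℝ} {γ : ℝ → Vec3}
    (h : IsConstAngle m ℓ a ζ I γ) :
    IsConstAngle m ℓ (-a) (-ζ) {s | -s ∈ I} (fun s => γ (-s)) := by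
  obtain ⟨p, q, h⟩ := h
  refine ⟨fun s => -p (-s), fun s => -q (-s), fun s hs => ?_⟩
  obtain ⟨hx, hy, hz, hp, hq, hpq⟩ := h (-s) hs
  have hn : HasDerivAt (fun t : ℝ => -t) (-1) s := (hasDerivAt_id s).neg
  refine ⟨?_, ?_, ?_, ?_, ?_, ?_⟩
  · exact (hx.comp s hn).congr_deriv (by ring)
  · exact (hy.comp s hn).congr_deriv (by ring)
  · exact (hz.comp s hn).congr_deriv (by ring)
  · exact (hp.comp s hn).neg.congr_deriv (by ring)
  · exact (hq.comp s hn).neg.congr_deriv (by ring)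
  · simpa using hpq

theorem eq_of_hasDerivAt_zero {I : Set ℝ} (hI : IsOpen I) (hc : I.OrdConnected) {f : ℝ → ℝ}
    (hf : ∀ s ∈ I, HasDerivAt f 0 s) {s t : ℝ} (hs : s ∈ I) (ht : t ∈ I) : f s = f t :=
  hI.is_const_of_deriv_eq_zero hc.isPreconnected
    (fun u hu => (hf u hu).differentiableAt.differentiableWithinAt)
    (fun u hu => (hf u hu).deriv) hs ht

namespace IsFrenetCurve3

/-- The Frenet equations in frame components, for the scalar products of `T, N, B` with `E₃`. -/
theorem hasDerivAt_vert {m ℓ : ℝ} {I : Set ℝ} {γ N B : ℝ → Vec3} {k₁ k₂ : ℝ → ℝ}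
    (h : IsFrenetCurve3 (metric m ℓ) (domain m) I γ N B k₁ k₂) (hI : IsOpen I) {s : ℝ}
    (hs : s ∈ I) :
    HasDerivAt (fun t => frameCoord m ℓ (γ t) (tangent γ t) 2)
      (k₁ s * frameCoord m ℓ (γ s) (N s) 2) s ∧
    HasDerivAt (fun t => frameCoord m ℓ (γ t) (N t) 2)
      (-k₁ s * frameCoord m ℓ (γ s) (tangent γ s) 2
        + (k₂ s - ℓ / 2) * frameCoord m ℓ (γ s) (B s) 2) s ∧
    HasDerivAt (fun t => frameCoord m ℓ (γ t) (B t) 2)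
      ((ℓ / 2 - k₂ s) * frameCoord m ℓ (γ s) (N s) 2) s := by
  have hF := h.conf_pos hs
  have hγ := differentiableAt_coord hI h.smooth hs
  have hO := h.isOrthoFrame hs
  refine ⟨?_, ?_, ?_⟩
  · refine (hasDerivAt_pi.1 (hasDerivAt_frameCoord m ℓ hF hγ
      (differentiableAt_coord hI (contDiffOn_tangent hI h.smooth) hs)) 2).congr_deriv ?_
    rw [h.deriv_T s hs, frameCoord_smul]
    simp only [Pi.sub_apply, Pi.smul_apply, smul_eq_mul, cross_apply, frameVel, Matrix.cons_val]
    ring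
  · have hc := congrFun hO.cross 2
    refine (hasDerivAt_pi.1 (hasDerivAt_frameCoord m ℓ hF hγ
      (differentiableAt_coord hI h.smooth_N hs)) 2).congr_deriv ?_
    rw [h.deriv_N s hs, frameCoord_add, frameCoord_smul, frameCoord_smul]
    simp only [Pi.sub_apply, Pi.add_apply, Pi.smul_apply, smul_eq_mul, cross_apply, frameVel,
      Matrix.cons_val] at hc ⊢
    linear_combination (ℓ / 2) * hc
  · have hc := congrFun hO.cross_tb 2
    refine (hasDerivAt_pi.1 (hasDerivAt_frameCoord m ℓ hF hγ
      (differentiableAt_coord hI h.smooth_B hs)) 2).congr_deriv ?_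
    rw [h.deriv_B s hs, frameCoord_smul]
    simp only [Pi.sub_apply, Pi.neg_apply, Pi.smul_apply, smul_eq_mul, cross_apply, frameVel,
      Matrix.cons_val] at hc ⊢
    linear_combination (-ℓ / 2) * hc

/-- If `N` is horizontal along a helix, then the helix is not vertical, and its torsion is determined
by its curvature and its slope. -/
theorem binormal_vert_of_normal_horizontal {m ℓ : ℝ} {I : Set ℝ} {γ N B : ℝ → Vec3} {κ τ : ℝ}
    (h : IsFrenetCurve3 (metric m ℓ) (domain m) I γ N B (fun _ => κ) (fun _ => τ))
    (hI : IsOpen I) (hN : ∀ s ∈ I, frameCoord m ℓ (γ s) (N s) 2 = 0) {s : ℝ} (hs : s ∈ I) :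
    κ * frameCoord m ℓ (γ s) (tangent γ s) 2 = (τ - ℓ / 2) * frameCoord m ℓ (γ s) (B s) 2 ∧
    frameCoord m ℓ (γ s) (B s) 2 ^ 2 = 1 - frameCoord m ℓ (γ s) (tangent γ s) 2 ^ 2 ∧
    frameCoord m ℓ (γ s) (B s) 2 ≠ 0 := by
  have h1 := (h.hasDerivAt_vert hI hs).2.1
  have h0 : HasDerivAt (fun t => frameCoord m ℓ (γ t) (N t) 2) 0 s :=
    (hasDerivAt_const s (0 : ℝ)).congr_of_eventuallyEq
      (Filter.eventuallyEq_of_mem (hI.mem_nhds hs) hN)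
  have e := h1.unique h0
  -- For a vertical tangent vector, `N₃' = 0` would read `κ T₃ = 0`.
  have hsq := (h.isOrthoFrame hs).sum_sq_vert
  rw [hN s hs] at hsq
  have hκ : 0 < κ := h.k₁_pos s hs
  refine ⟨by linarith, by linarith, fun hb => ?_⟩
  rw [hb] at e hsq
  have : frameCoord m ℓ (γ s) (tangent γ s) 2 = 0 := by
    have : κ * frameCoord m ℓ (γ s) (tangent γ s) 2 = 0 := by linarith
    simpa [hκ.ne'] using this
  rw [this] at hsq
  norm_num at hsq

end IsFrenetCurve3

/-- The normal component of the tension field of a helix with `κ = ζ b`, `κ a = (τ - ℓ / 2) b` is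
the quartic. -/
theorem normal_component_eq_helixQuartic {m ℓ n κ τ a b ζ : ℝ} (hb : b ≠ 0)
    (hab : b ^ 2 = 1 - a ^ 2) (hκ : κ = ζ * b) (hτ : κ * a = (τ - ℓ / 2) * b) :
    (κ ^ 2 + τ ^ 2) ^ 2 - (κ ^ 2 + τ ^ 2 + n * κ ^ 2) * (ℓ ^ 2 / 4 + (4 * m - ℓ ^ 2) * b ^ 2)
      - n * κ * τ * ((4 * m - ℓ ^ 2) * a * b) = helixQuartic m ℓ n a ζ := by
  have hτ' : τ = ζ * a + ℓ / 2 := by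
    have : (τ - ℓ / 2 - ζ * a) * b = 0 := by rw [sub_mul, ← hτ, hκ]; ring
    have := (mul_eq_zero.1 this).resolve_right hb
    linarith
  have hω : κ ^ 2 + τ ^ 2 = ζ ^ 2 + ℓ * a * ζ + ℓ ^ 2 / 4 := by
    rw [hκ, hτ', mul_pow, hab]; ring
  rw [hω, hκ, mul_pow, hab, hτ', helixQuartic]
  linear_combination (-n * ζ * (ζ * a + ℓ / 2) * (4 * m - ℓ ^ 2) * a) * hab

/-- If `N` had a vertical component, the vanishing of the tension field would force
`κ² + τ² = ℓ τ / 2` and `κ² + τ² + n κ² = τ²`. -/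
theorem false_of_degenerate {ℓ n κ τ : ℝ} (hn : 0 ≤ n) (hκ : 0 < κ)
    (h1 : (κ ^ 2 + τ ^ 2) ^ 2 = ℓ ^ 2 / 4 * (κ ^ 2 + τ ^ 2 + n * κ ^ 2))
    (h2 : (κ ^ 2 + τ ^ 2 + n * κ ^ 2) * (ℓ / 2 - τ) + n * κ ^ 2 * τ = 0) : False := by
  have hω : 0 < κ ^ 2 + τ ^ 2 := by positivity
  have h3 : (κ ^ 2 + τ ^ 2 + n * κ ^ 2) * (ℓ / 2) = τ * (κ ^ 2 + τ ^ 2) := by linarith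
  have h4 : (κ ^ 2 + τ ^ 2 + n * κ ^ 2 - τ ^ 2) * (κ ^ 2 + τ ^ 2) ^ 2 = 0 := by
    linear_combination (κ ^ 2 + τ ^ 2 + n * κ ^ 2) * h1
      + ((κ ^ 2 + τ ^ 2 + n * κ ^ 2) * (ℓ / 2) + τ * (κ ^ 2 + τ ^ 2)) * h3
  have h5 := (mul_eq_zero.1 h4).resolve_right (by positivity)
  have : 0 < κ ^ 2 := by positivity
  have : 0 ≤ n * κ ^ 2 := by positivity
  linarith

namespace IsFrenetCurve3

/-- The principal normal of an `r`-harmonic helix is horizontal. -/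
theorem normal_horizontal {m ℓ : ℝ} (hmℓ : 4 * m ≠ ℓ ^ 2) {I : Set ℝ} {γ N B : ℝ → Vec3}
    {κ τ : ℝ} (h : IsFrenetCurve3 (metric m ℓ) (domain m) I γ N B (fun _ => κ) (fun _ => τ))
    (hI : IsOpen I) {n : ℕ} (hr : ∀ s ∈ I, rTension (metric m ℓ) (n + 2) γ s = 0) {s : ℝ}
    (hs : s ∈ I) : frameCoord m ℓ (γ s) (N s) 2 = 0 := by
  by_contra hN
  have hκ : 0 < κ := h.k₁_pos s hs
  have hd : 4 * m - ℓ ^ 2 ≠ 0 := sub_ne_zero.2 hmℓ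
  obtain ⟨ht, hn, hb⟩ := h.hasDerivAt_vert hI hs
  -- Near `s` the vertical component of `N` does not vanish, so the other factor of the binormal
  -- component of the tension field vanishes identically and can be differentiated.
  have hw : ∀ u ∈ I, frameCoord m ℓ (γ u) (N u) 2 ≠ 0 →
      (κ ^ 2 + τ ^ 2 + n * κ ^ 2) * frameCoord m ℓ (γ u) (B u) 2
        + n * κ * τ * frameCoord m ℓ (γ u) (tangent γ u) 2 = 0 := fun u hu hNu =>
    (mul_eq_zero.1 ((h.rTension_eq_zero_iff hI n hu).1 (hr u hu)).2).resolve_left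
      (mul_ne_zero hd hNu)
  have hev : (fun u => (κ ^ 2 + τ ^ 2 + n * κ ^ 2) * frameCoord m ℓ (γ u) (B u) 2
        + n * κ * τ * frameCoord m ℓ (γ u) (tangent γ u) 2) =ᶠ[nhds s] fun _ => 0 := by
    filter_upwards [hI.mem_nhds hs, hn.continuousAt.eventually_ne hN] with u hu hNu
    exact hw u hu hNu
  have hder := ((hb.const_mul (κ ^ 2 + τ ^ 2 + n * κ ^ 2)).add
    (ht.const_mul (n * κ * τ))).unique ((hasDerivAt_const s (0 : ℝ)).congr_of_eventuallyEq hev)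
  have h2 : (κ ^ 2 + τ ^ 2 + n * κ ^ 2) * (ℓ / 2 - τ) + n * κ ^ 2 * τ = 0 := by
    refine (mul_eq_zero.1 (?_ : _ * frameCoord m ℓ (γ s) (N s) 2 = 0)).resolve_right hN
    linear_combination hder
  have h1 := ((h.rTension_eq_zero_iff hI n hs).1 (hr s hs)).1
  refine false_of_degenerate (Nat.cast_nonneg n) hκ (ℓ := ℓ) (τ := τ) ?_ h2
  linear_combination h1
    + (4 * m - ℓ ^ 2) * frameCoord m ℓ (γ s) (B s) 2 * hw s hs hN

/-- The equation `∇_T T = k₁ N` in frame components. -/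
theorem hasDerivAt_tangent {m ℓ : ℝ} {I : Set ℝ} {γ N B : ℝ → Vec3} {k₁ k₂ : ℝ → ℝ}
    (h : IsFrenetCurve3 (metric m ℓ) (domain m) I γ N B k₁ k₂) (hI : IsOpen I) {s : ℝ}
    (hs : s ∈ I) :
    HasDerivAt (fun t => frameCoord m ℓ (γ t) (tangent γ t))
      (k₁ s • frameCoord m ℓ (γ s) (N s)
        + (2 * m * (γ s 0 * frameCoord m ℓ (γ s) (tangent γ s) 1
            - γ s 1 * frameCoord m ℓ (γ s) (tangent γ s) 0)
          + ℓ * frameCoord m ℓ (γ s) (tangent γ s) 2) •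
          ![-frameCoord m ℓ (γ s) (tangent γ s) 1, frameCoord m ℓ (γ s) (tangent γ s) 0, 0]) s := by
  refine (hasDerivAt_frameCoord m ℓ (h.conf_pos hs) (differentiableAt_coord hI h.smooth hs)
    (differentiableAt_coord hI (contDiffOn_tangent hI h.smooth) hs)).congr_deriv ?_
  rw [h.deriv_T s hs, frameCoord_smul]
  ext i
  fin_cases i <;> simp [cross_apply, frameVel] <;> ring

end IsFrenetCurve3

/-! ### Characterization of the `r`-harmonic helices -/

/-- The frame components of the tangent vector of a curve in terms of its coordinate derivatives. -/
theorem frameCoord_tangent {m ℓ p q a : ℝ} {γ : ℝ → Vec3} {s : ℝ} (hF : conf m (γ s) ≠ 0)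
    (hx : HasDerivAt (fun t => γ t 0) (conf m (γ s) * p) s)
    (hy : HasDerivAt (fun t => γ t 1) (conf m (γ s) * q) s)
    (hz : HasDerivAt (fun t => γ t 2) (a + ℓ / 2 * (γ s 0 * q - γ s 1 * p)) s) :
    frameCoord m ℓ (γ s) (tangent γ s) = ![p, q, a] := by
  ext i
  fin_cases i <;> simp [frameCoord, tangent, hx.deriv, hy.deriv, hz.deriv] <;> field_simp
  ring

namespace IsFrenetCurve3

/-- A helix of constant angle with constants `a, ζ` is `r`-harmonic, `r = n + 2`, if and only if
these solve the quartic. -/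
theorem rTension_eq_zero_iff_helixQuartic {m ℓ a ζ : ℝ} {I : Set ℝ} {γ N B : ℝ → Vec3} {κ τ : ℝ}
    (h : IsFrenetCurve3 (metric m ℓ) (domain m) I γ N B (fun _ => κ) (fun _ => τ))
    (hI : IsOpen I) (hγ : IsConstAngle m ℓ a ζ I γ) (n : ℕ) {s : ℝ} (hs : s ∈ I) :
    rTension (metric m ℓ) (n + 2) γ s = 0 ↔ helixQuartic m ℓ n a ζ = 0 := by
  have hκ : 0 < κ := h.k₁_pos s hs
  obtain ⟨p, q, hpq⟩ := hγ
  have hT : ∀ u ∈ I, frameCoord m ℓ (γ u) (tangent γ u) = ![p u, q u, a] := by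
    intro u hu
    obtain ⟨hx, hy, hz, -⟩ := hpq u hu
    exact frameCoord_tangent (h.conf_pos hu).ne' hx hy hz
  have hN : ∀ u ∈ I, κ • frameCoord m ℓ (γ u) (N u) = ζ • ![-q u, p u, 0] := by
    intro u hu
    obtain ⟨-, -, -, hp, hq, -⟩ := hpq u hu
    have h1 := h.hasDerivAt_tangent hI hu
    have h2 : HasDerivAt (fun t => ![p t, q t, a])
        ((2 * m * (γ u 0 * q u - γ u 1 * p u) + ℓ * a + ζ) • ![-q u, p u, 0]) u := by
      rw [hasDerivAt_pi]
      intro i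
      fin_cases i
      · exact hp.congr_deriv (by simp; ring)
      · exact hq.congr_deriv (by simp; ring)
      · exact (hasDerivAt_const u a).congr_deriv (by simp)
    have h3 := h1.unique
      (h2.congr_of_eventuallyEq (Filter.eventuallyEq_of_mem (hI.mem_nhds hu) hT))
    rw [hT u hu] at h3
    simp only [Matrix.cons_val] at h3
    rw [add_smul _ ζ] at h3
    exact add_right_cancel (h3.trans (add_comm _ _))
  have hN2 : ∀ u ∈ I, frameCoord m ℓ (γ u) (N u) 2 = 0 := by
    intro u hu
    simpa [hκ.ne'] using congrFun (hN u hu) 2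
  obtain ⟨hτ, hb2, hb⟩ := h.binormal_vert_of_normal_horizontal hI hN2 hs
  have hcross := congrFun (h.isOrthoFrame hs).cross 2
  have hN0 := congrFun (hN s hs) 0
  have hN1 := congrFun (hN s hs) 1
  have hsq := (hpq s hs).2.2.2.2.2
  rw [h.rTension_eq_zero_iff hI n hs, hN2 s hs]
  rw [hT s hs] at hτ hb2 hcross ⊢
  simp only [Matrix.cons_val, cross_apply, Pi.smul_apply, smul_eq_mul] at hτ hb2 hcross hN0 hN1 ⊢
  have hκζ : κ = ζ * frameCoord m ℓ (γ s) (B s) 2 := by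
    refine mul_right_cancel₀ hb ?_
    linear_combination κ * hcross + p s * hN1 - q s * hN0 + ζ * hsq - ζ * hb2
  rw [← normal_component_eq_helixQuartic (m := m) (n := n) hb hb2 hκζ hτ]
  simp

/-- An `r`-harmonic helix, `r = n + 2`, makes a constant angle with `E₃`. -/
theorem exists_isConstAngle {m ℓ : ℝ} (hmℓ : 4 * m ≠ ℓ ^ 2) {I : Set ℝ} {γ N B : ℝ → Vec3}
    {κ τ : ℝ} (h : IsFrenetCurve3 (metric m ℓ) (domain m) I γ N B (fun _ => κ) (fun _ => τ))
    (hI : IsOpen I) (hc : I.OrdConnected) (hne : I.Nonempty) {n : ℕ}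
    (hr : ∀ s ∈ I, rTension (metric m ℓ) (n + 2) γ s = 0) :
    ∃ a ζ : ℝ, a ^ 2 < 1 ∧ ζ ≠ 0 ∧ helixQuartic m ℓ n a ζ = 0 ∧ IsConstAngle m ℓ a ζ I γ := by
  obtain ⟨s₀, hs₀⟩ := hne
  have hκ : 0 < κ := h.k₁_pos s₀ hs₀
  have hN2 : ∀ u ∈ I, frameCoord m ℓ (γ u) (N u) 2 = 0 := fun u hu =>
    h.normal_horizontal hmℓ hI hr hu
  obtain ⟨-, hb2, hb⟩ := h.binormal_vert_of_normal_horizontal hI hN2 hs₀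
  obtain ⟨a, ha⟩ : ∃ a, a = frameCoord m ℓ (γ s₀) (tangent γ s₀) 2 := ⟨_, rfl⟩
  obtain ⟨b, hb'⟩ : ∃ b, b = frameCoord m ℓ (γ s₀) (B s₀) 2 := ⟨_, rfl⟩
  rw [← ha, ← hb'] at hb2
  rw [← hb'] at hb
  have hTa : ∀ u ∈ I, frameCoord m ℓ (γ u) (tangent γ u) 2 = a := fun u hu => ha ▸
    eq_of_hasDerivAt_zero hI hc (f := fun t => frameCoord m ℓ (γ t) (tangent γ t) 2)
      (fun v hv => (h.hasDerivAt_vert hI hv).1.congr_deriv (by rw [hN2 v hv, mul_zero])) hu hs₀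
  have hBb : ∀ u ∈ I, frameCoord m ℓ (γ u) (B u) 2 = b := fun u hu => hb' ▸
    eq_of_hasDerivAt_zero hI hc (f := fun t => frameCoord m ℓ (γ t) (B t) 2)
      (fun v hv => (h.hasDerivAt_vert hI hv).2.2.congr_deriv (by rw [hN2 v hv, mul_zero])) hu hs₀
  have hγ : IsConstAngle m ℓ a (κ / b) I γ := by
    refine ⟨fun t => frameCoord m ℓ (γ t) (tangent γ t) 0,
      fun t => frameCoord m ℓ (γ t) (tangent γ t) 1, fun s hs => ?_⟩
    have hF := (h.conf_pos hs).ne'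
    have hd := fun i => (differentiableAt_coord hI h.smooth hs i).hasDerivAt
    have hcv := (h.isOrthoFrame hs).cross_vert
    rw [hN2 s hs, hBb s hs, zero_smul, zero_sub] at hcv
    have hc0 := congrFun hcv 0
    have hc1 := congrFun hcv 1
    have ht := hasDerivAt_pi.1 (h.hasDerivAt_tangent hI hs)
    have htt := (h.isOrthoFrame hs).tt
    have hTs := hTa s hs
    rw [dotProduct, Fin.sum_univ_three] at htt
    rw [hTs] at ht htt
    simp only [cross_apply, Matrix.cons_val, Pi.neg_apply, Pi.smul_apply, smul_eq_mul] at hc0 hc1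
    refine ⟨(hd 0).congr_deriv ?_, (hd 1).congr_deriv ?_, (hd 2).congr_deriv ?_,
      (ht 0).congr_deriv ?_, (ht 1).congr_deriv ?_, by linarith⟩
    · simp [frameCoord, tangent]; field_simp
    · simp [frameCoord, tangent]; field_simp
    · rw [← hTs]; simp [frameCoord, tangent]; ring
    · simp
      field_simp
      linear_combination κ * hc0
    · simp
      field_simp
      linear_combination κ * hc1
  refine ⟨a, κ / b, ?_, div_ne_zero hκ.ne' hb, ?_, hγ⟩
  · have : 0 < b ^ 2 := by positivity
    linarith
  · exact (h.rTension_eq_zero_iff_helixQuartic hI hγ n hs₀).1 (hr s₀ hs₀)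

theorem not_isGeodesicOn {m ℓ : ℝ} {I : Set ℝ} {γ N B : ℝ → Vec3} {k₁ k₂ : ℝ → ℝ}
    (h : IsFrenetCurve3 (metric m ℓ) (domain m) I γ N B k₁ k₂) (hne : I.Nonempty) :
    ¬ IsGeodesicOn (metric m ℓ) I γ := by
  obtain ⟨s, hs⟩ := hne
  intro hg
  have h1 := h.deriv_T s hs
  rw [hg s hs] at h1
  have h2 := h.inner_NN s hs
  rw [(smul_eq_zero_iff_right (h.k₁_pos s hs).ne').1 h1.symm] at h2
  simp [metricInner] at h2

end IsFrenetCurve3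

/-! ### Lifting the angle -/

/-- A function on an open interval with given continuous derivative and given value at a point. -/
theorem exists_hasDerivAt_of_continuousOn {I : Set ℝ} (hI : IsOpen I) (hc : I.OrdConnected)
    {G : ℝ → ℝ} (hG : ContinuousOn G I) {s₀ : ℝ} (hs₀ : s₀ ∈ I) (θ : ℝ) :
    ∃ β : ℝ → ℝ, β s₀ = θ ∧ ∀ s ∈ I, HasDerivAt β (G s) s := by
  refine ⟨fun s => θ + ∫ t in s₀..s, G t, by simp, fun s hs => ?_⟩
  refine (intervalIntegral.integral_hasDerivAt_right ?_ ?_ ?_).const_add θ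
  · exact (hG.mono (hc.uIcc_subset hs₀ hs)).intervalIntegrable
  · exact hG.stronglyMeasurableAtFilter hI s hs
  · exact hG.continuousAt (hI.mem_nhds hs)

/-- A differentiable lift of the angle of the horizontal part of the tangent vector. -/
theorem exists_angle {I : Set ℝ} (hI : IsOpen I) (hc : I.OrdConnected) (hne : I.Nonempty)
    {p q G : ℝ → ℝ} (hp : ∀ s ∈ I, HasDerivAt p (-(q s * G s)) s)
    (hq : ∀ s ∈ I, HasDerivAt q (p s * G s) s) (hG : ContinuousOn G I) {ρ : ℝ} (hρ : 0 ≤ ρ)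
    (hpq : ∀ s ∈ I, p s ^ 2 + q s ^ 2 = ρ ^ 2) :
    ∃ β : ℝ → ℝ, ∀ s ∈ I, HasDerivAt β (G s) s ∧ p s = ρ * cos (β s) ∧ q s = ρ * sin (β s) := by
  obtain ⟨s₀, hs₀⟩ := hne
  obtain ⟨θ, hθp, hθq⟩ : ∃ θ, p s₀ = ρ * cos θ ∧ q s₀ = ρ * sin θ := by
    have hnorm : ‖(⟨p s₀, q s₀⟩ : ℂ)‖ = ρ := by
      rw [Complex.norm_def, Complex.normSq_mk, ← pow_two, ← pow_two, hpq s₀ hs₀, sqrt_sq hρ]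
    refine ⟨Complex.arg ⟨p s₀, q s₀⟩, ?_, ?_⟩
    · rw [← hnorm, Complex.norm_mul_cos_arg]
    · rw [← hnorm, Complex.norm_mul_sin_arg]
  obtain ⟨β, hβ₀, hβ⟩ := exists_hasDerivAt_of_continuousOn hI hc hG hs₀ θ
  refine ⟨β, fun s hs => ⟨hβ s hs, ?_⟩⟩
  -- The components of `(p, q)` along `(cos β, sin β)` and its rotation by a right angle are
  -- constant.
  have h1 : p s * cos (β s) + q s * sin (β s) = p s₀ * cos (β s₀) + q s₀ * sin (β s₀) :=
    eq_of_hasDerivAt_zero hI hc (f := fun t => p t * cos (β t) + q t * sin (β t))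
      (fun u hu => (((hp u hu).mul (hβ u hu).cos).add ((hq u hu).mul (hβ u hu).sin)).congr_deriv
        (by ring)) hs hs₀
  have h2 : q s * cos (β s) - p s * sin (β s) = q s₀ * cos (β s₀) - p s₀ * sin (β s₀) :=
    eq_of_hasDerivAt_zero hI hc (f := fun t => q t * cos (β t) - p t * sin (β t))
      (fun u hu => (((hq u hu).mul (hβ u hu).cos).sub ((hp u hu).mul (hβ u hu).sin)).congr_deriv
        (by ring)) hs hs₀
  rw [hβ₀, hθp, hθq] at h1 h2
  have e0 := sin_sq_add_cos_sq θ
  have e1 := sin_sq_add_cos_sq (β s)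
  constructor
  · linear_combination cos (β s) * h1 - sin (β s) * h2 - p s * e1 + ρ * cos (β s) * e0
  · linear_combination sin (β s) * h1 + cos (β s) * h2 - q s * e1 + ρ * sin (β s) * e0

/-! ### Integration of the equations of constant angle -/

theorem hasDerivAt_conf {m p q : ℝ} {γ : ℝ → Vec3} {s : ℝ}
    (hx : HasDerivAt (fun t => γ t 0) (conf m (γ s) * p) s)
    (hy : HasDerivAt (fun t => γ t 1) (conf m (γ s) * q) s) :
    HasDerivAt (fun t => conf m (γ t)) (2 * m * conf m (γ s) * (γ s 0 * p + γ s 1 * q)) s := by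
  refine ((((hx.pow 2).add (hy.pow 2)).const_mul m).const_add 1).congr_deriv ?_
  simp
  ring

/-- The case `β' = k F`, `k ≠ 0`, of the constant angle equations; the radius of the circle is
`k⁻¹ sin α`. -/
theorem isTypeI_of_angle {m ℓ α ζ k : ℝ} (hm : m ≠ 0) {I : Set ℝ} (hI : IsOpen I)
    (hc : I.OrdConnected) (hne : I.Nonempty) {γ : ℝ → Vec3} {β : ℝ → ℝ} (hk : k ≠ 0)
    (hF : ∀ s ∈ I, conf m (γ s) ≠ 0)
    (hx : ∀ s ∈ I, HasDerivAt (fun t => γ t 0) (conf m (γ s) * (sin α * cos (β s))) s)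
    (hy : ∀ s ∈ I, HasDerivAt (fun t => γ t 1) (conf m (γ s) * (sin α * sin (β s))) s)
    (hz : ∀ s ∈ I, HasDerivAt (fun t => γ t 2)
      (cos α + ℓ / 2 * (γ s 0 * (sin α * sin (β s)) - γ s 1 * (sin α * cos (β s)))) s)
    (hβ : ∀ s ∈ I, HasDerivAt β (k * conf m (γ s)) s)
    (hG : ∀ s ∈ I, k * conf m (γ s) = 2 * m * (γ s 0 * (sin α * sin (β s))
      - γ s 1 * (sin α * cos (β s))) + ℓ * cos α + ζ) :
    IsTypeI m ℓ α ζ I γ := by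
  obtain ⟨s₀, hs₀⟩ := hne
  -- `β' = k F` integrates the equations for `x`, `y` and `z`.
  obtain ⟨c₁, hc₁⟩ : ∃ c, ∀ s ∈ I, γ s 0 - k⁻¹ * sin α * sin (β s) = c :=
    ⟨_, fun s hs => eq_of_hasDerivAt_zero hI hc
      (f := fun t => γ t 0 - k⁻¹ * sin α * sin (β t)) (fun u hu =>
      ((hx u hu).sub ((hβ u hu).sin.const_mul (k⁻¹ * sin α))).congr_deriv
        (by field_simp; ring)) hs hs₀⟩
  obtain ⟨c₂, hc₂⟩ : ∃ c, ∀ s ∈ I, γ s 1 + k⁻¹ * sin α * cos (β s) = c :=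
    ⟨_, fun s hs => eq_of_hasDerivAt_zero hI hc
      (f := fun t => γ t 1 + k⁻¹ * sin α * cos (β t)) (fun u hu =>
      ((hy u hu).add ((hβ u hu).cos.const_mul (k⁻¹ * sin α))).congr_deriv
        (by field_simp; ring)) hs hs₀⟩
  obtain ⟨c₃, hc₃⟩ : ∃ c, ∀ s ∈ I, γ s 2 - (ℓ / (4 * m) * β s + slope m ℓ α ζ * s) = c :=
    ⟨_, fun s hs => eq_of_hasDerivAt_zero hI hc
      (f := fun t => γ t 2 - (ℓ / (4 * m) * β t + slope m ℓ α ζ * t)) (fun u hu =>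
      ((hz u hu).sub (((hβ u hu).const_mul (ℓ / (4 * m))).add
        ((hasDerivAt_id u).const_mul (slope m ℓ α ζ)))).congr_deriv
        (by rw [hG u hu, slope]; field_simp; ring)) hs hs₀⟩
  have hx' : ∀ s ∈ I, γ s 0 = k⁻¹ * sin α * sin (β s) + c₁ := fun s hs => by
    rw [← hc₁ s hs]; ring
  have hy' : ∀ s ∈ I, γ s 1 = -(k⁻¹ * sin α * cos (β s)) + c₂ := fun s hs => by
    rw [← hc₂ s hs]; ring
  have hG' : ∀ s ∈ I, k * conf m (γ s) = 2 * m * sin α * (c₁ * sin (β s) - c₂ * cos (β s))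
      + 2 * m * k⁻¹ * sin α ^ 2 + ζ + ℓ * cos α := fun s hs => by
    rw [hG s hs, hx' s hs, hy' s hs]
    linear_combination (2 * m * k⁻¹ * sin α ^ 2) * sin_sq_add_cos_sq (β s)
  refine ⟨k⁻¹, c₁, c₂, c₃, β, inv_ne_zero hk, ?_, fun s hs => ?_, ?_, fun s hs => ?_⟩
  · have h1 := hG' s₀ hs₀
    have h2 : conf m (γ s₀) = 1 + m * (γ s₀ 0 ^ 2 + γ s₀ 1 ^ 2) := rfl
    rw [hx' s₀ hs₀, hy' s₀ hs₀] at h2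
    rw [h2] at h1
    field_simp at h1 ⊢
    linear_combination h1 - m * sin α ^ 2 * sin_sq_add_cos_sq (β s₀)
  · exact (hβ s hs).congr_deriv (hG' s hs)
  · rintro ⟨b, hb⟩
    have h0 : HasDerivAt β 0 s₀ := (hasDerivAt_const s₀ b).congr_of_eventuallyEq
      (Filter.eventuallyEq_of_mem (hI.mem_nhds hs₀) hb)
    exact mul_ne_zero hk (hF s₀ hs₀) ((hβ s₀ hs₀).unique h0)
  · refine ⟨hx' s hs, hy' s hs, ?_⟩
    rw [← hc₃ s hs]; ring

/-- The case of a constant angle `β = β₀` of the constant angle equations. -/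
theorem isTypeIIOrIII_of_angle {m ℓ α ζ β₀ : ℝ} (hm : m ≠ 0) (hα : sin α ≠ 0) {I : Set ℝ}
    (hI : IsOpen I) (hc : I.OrdConnected) (hne : I.Nonempty) {γ : ℝ → Vec3}
    (hx : ∀ s ∈ I, HasDerivAt (fun t => γ t 0) (conf m (γ s) * (sin α * cos β₀)) s)
    (hy : ∀ s ∈ I, HasDerivAt (fun t => γ t 1) (conf m (γ s) * (sin α * sin β₀)) s)
    (hz : ∀ s ∈ I, HasDerivAt (fun t => γ t 2)
      (cos α + ℓ / 2 * (γ s 0 * (sin α * sin β₀) - γ s 1 * (sin α * cos β₀))) s)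
    (hG : ∀ s ∈ I, 2 * m * (γ s 0 * (sin α * sin β₀)
      - γ s 1 * (sin α * cos β₀)) + ℓ * cos α + ζ = 0) :
    IsTypeII m ℓ α ζ I γ ∨ IsTypeIII m ℓ α ζ I γ := by
  obtain ⟨s₀, hs₀⟩ := hne
  obtain ⟨c₃, hc₃⟩ : ∃ c, ∀ s ∈ I, γ s 2 - slope m ℓ α ζ * s = c :=
    ⟨_, fun s hs => eq_of_hasDerivAt_zero hI hc (f := fun t => γ t 2 - slope m ℓ α ζ * t)
      (fun u hu => ((hz u hu).sub ((hasDerivAt_id u).const_mul (slope m ℓ α ζ))).congr_deriv (by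
        rw [slope]
        field_simp
        linear_combination (2 * ℓ) * hG u hu)) hs hs₀⟩
  have hz' : ∀ s ∈ I, γ s 2 = slope m ℓ α ζ * s + c₃ := fun s hs => by rw [← hc₃ s hs]; ring
  by_cases h1 : cos β₀ = 0
  · have h2 : sin β₀ ≠ 0 := fun h => by
      have := sin_sq_add_cos_sq β₀
      rw [h, h1] at this
      norm_num at this
    have hsq : sin β₀ ^ 2 = 1 := by
      have := sin_sq_add_cos_sq β₀
      rw [h1] at this
      linarith
    refine Or.inr ⟨β₀, c₃, hz', Or.inl ⟨h1, _, rfl, fun s hs => ?_⟩⟩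
    have hx0 : γ s 0 = -((ζ + ℓ * cos α) / (2 * m * sin α * sin β₀)) := by
      have := hG s hs
      rw [h1] at this
      field_simp
      linear_combination this
    refine ⟨hx0, (hy s hs).differentiableAt, ?_⟩
    rw [(hy s hs).deriv, ← hx0, conf]
    linear_combination (1 + m * (γ s 0 ^ 2 + γ s 1 ^ 2)) ^ 2 * sin α ^ 2 * hsq
  by_cases h2 : sin β₀ = 0
  · have hsq : cos β₀ ^ 2 = 1 := by
      have := sin_sq_add_cos_sq β₀
      rw [h2] at this
      linarith
    refine Or.inr ⟨β₀, c₃, hz', Or.inr ⟨h2, _, rfl, fun s hs => ?_⟩⟩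
    have hy0 : γ s 1 = (ζ + ℓ * cos α) / (2 * m * sin α * cos β₀) := by
      have := hG s hs
      rw [h2] at this
      field_simp
      linear_combination -this
    refine ⟨hy0, (hx s hs).differentiableAt, ?_⟩
    rw [(hx s hs).deriv, ← hy0, conf]
    linear_combination (1 + m * (γ s 0 ^ 2 + γ s 1 ^ 2)) ^ 2 * sin α ^ 2 * hsq
  · refine Or.inl ⟨β₀, _, c₃, mul_ne_zero h2 h1, rfl, fun s hs => ?_⟩
    have hy1 : γ s 1 = γ s 0 * tan β₀ + (ζ + ℓ * cos α) / (2 * m * sin α * cos β₀) := by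
      have := hG s hs
      rw [tan_eq_sin_div_cos]
      field_simp
      linear_combination -this
    exact ⟨by rw [← hy1]; exact hx s hs, hy1, hz' s hs⟩

theorem isTypeIToIII_of_isConstAngle {m ℓ α ζ : ℝ} (hm : m ≠ 0) (hα : 0 < sin α) {I : Set ℝ}
    (hI : IsOpen I) (hc : I.OrdConnected) (hne : I.Nonempty) {γ : ℝ → Vec3}
    (hF : ∀ s ∈ I, conf m (γ s) ≠ 0) (hγ : IsConstAngle m ℓ (cos α) ζ I γ) :
    IsTypeIToIII m ℓ α ζ I γ := by
  obtain ⟨p, q, h⟩ := hγ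
  obtain ⟨G, hGdef⟩ : ∃ G : ℝ → ℝ, ∀ s, G s
      = 2 * m * (γ s 0 * q s - γ s 1 * p s) + ℓ * cos α + ζ := ⟨_, fun _ => rfl⟩
  simp only [← hGdef] at h
  have hG' : ∀ s ∈ I, HasDerivAt G (2 * m * G s * (γ s 0 * p s + γ s 1 * q s)) s := by
    intro s hs
    obtain ⟨hx, hy, -, hp, hq, -⟩ := h s hs
    refine HasDerivAt.congr_of_eventuallyEq ?_ (Filter.Eventually.of_forall hGdef)
    refine (((((hx.mul hq).sub (hy.mul hp)).const_mul (2 * m)).add_const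
      (ℓ * cos α)).add_const ζ).congr_deriv ?_
    ring
  obtain ⟨β, hβ⟩ := exists_angle hI hc hne (fun s hs => (h s hs).2.2.2.1)
    (fun s hs => (h s hs).2.2.2.2.1) (fun s hs => (hG' s hs).continuousAt.continuousWithinAt)
    hα.le (fun s hs => by rw [(h s hs).2.2.2.2.2, sin_sq])
  have hne' := hne
  obtain ⟨s₀, hs₀⟩ := hne
  -- `β' = G` and `F` have the same logarithmic derivative.
  obtain ⟨k, hk⟩ : ∃ k, ∀ s ∈ I, G s / conf m (γ s) = k :=
    ⟨_, fun s hs => eq_of_hasDerivAt_zero hI hc (f := fun t => G t / conf m (γ t)) (fun u hu =>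
      ((hG' u hu).div (hasDerivAt_conf (h u hu).1 (h u hu).2.1) (hF u hu)).congr_deriv (by
        have := hF u hu
        field_simp
        ring)) hs hs₀⟩
  have hk' : ∀ s ∈ I, G s = k * conf m (γ s) := fun s hs => by
    rw [← hk s hs, div_mul_cancel₀ _ (hF s hs)]
  by_cases hk0 : k = 0
  · have hG0 : ∀ s ∈ I, G s = 0 := fun s hs => by rw [hk' s hs, hk0, zero_mul]
    have hβc : ∀ s ∈ I, β s = β s₀ := fun s hs => eq_of_hasDerivAt_zero hI hc
      (fun u hu => hG0 u hu ▸ (hβ u hu).1) hs hs₀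
    have hp : ∀ s ∈ I, p s = sin α * cos (β s₀) := fun s hs => by
      rw [(hβ s hs).2.1, hβc s hs]
    have hq : ∀ s ∈ I, q s = sin α * sin (β s₀) := fun s hs => by
      rw [(hβ s hs).2.2, hβc s hs]
    refine Or.inr (isTypeIIOrIII_of_angle (β₀ := β s₀) hm hα.ne' hI hc hne' ?_ ?_ ?_ ?_) <;>
      intro s hs
    · rw [← hp s hs]; exact (h s hs).1
    · rw [← hq s hs]; exact (h s hs).2.1
    · rw [← hp s hs, ← hq s hs]; exact (h s hs).2.2.1
    · rw [← hp s hs, ← hq s hs, ← hGdef, hG0 s hs]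
  · refine Or.inl (isTypeI_of_angle (β := β) hm hI hc hne' hk0 hF ?_ ?_ ?_ ?_ ?_) <;>
      intro s hs
    · rw [← (hβ s hs).2.1]; exact (h s hs).1
    · rw [← (hβ s hs).2.2]; exact (h s hs).2.1
    · rw [← (hβ s hs).2.1, ← (hβ s hs).2.2]; exact (h s hs).2.2.1
    · rw [← hk' s hs]; exact (hβ s hs).1
    · rw [← (hβ s hs).2.1, ← (hβ s hs).2.2, ← hk' s hs, hGdef]

/-! ### Curves of Types I, II and III have constant angle -/

/-- The equation `μ β' = F` along a curve of Type I. -/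
theorem conf_eq_of_circle {m ℓ α ζ μ c₁ c₂ b : ℝ} (hm : m ≠ 0) (hμ : μ ≠ 0)
    (hc : c₁ ^ 2 + c₂ ^ 2 = μ / m * ((ℓ * cos α + ζ - 1 / μ) + m * μ * sin α ^ 2)) :
    1 + m * ((μ * sin α * sin b + c₁) ^ 2 + (-(μ * sin α * cos b) + c₂) ^ 2)
      = μ * (2 * m * sin α * (c₁ * sin b - c₂ * cos b)
        + 2 * m * μ * sin α ^ 2 + ζ + ℓ * cos α) := by
  field_simp at hc
  linear_combination hc + m * μ ^ 2 * sin α ^ 2 * sin_sq_add_cos_sq b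

theorem IsTypeI.isConstAngle {m ℓ α ζ : ℝ} (hm : m ≠ 0) {I : Set ℝ} (hI : IsOpen I)
    {γ : ℝ → Vec3} (h : IsTypeI m ℓ α ζ I γ) : IsConstAngle m ℓ (cos α) ζ I γ := by
  obtain ⟨μ, c₁, c₂, c₃, β, hμ, hc, hβ, -, hγ⟩ := h
  refine ⟨fun s => sin α * cos (β s), fun s => sin α * sin (β s), fun s hs => ?_⟩
  have hF : conf m (γ s) = μ * (2 * m * sin α * (c₁ * sin (β s) - c₂ * cos (β s))
        + 2 * m * μ * sin α ^ 2 + ζ + ℓ * cos α) := by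
    rw [conf, (hγ s hs).1, (hγ s hs).2.1]
    exact conf_eq_of_circle hm hμ hc
  have hβs := hβ s hs
  have e1 := sin_sq_add_cos_sq (β s)
  have hn := hI.mem_nhds hs
  refine ⟨?_, ?_, ?_, ?_, ?_, ?_⟩
  · refine HasDerivAt.congr_of_eventuallyEq (((hβs.sin.const_mul (μ * sin α)).add_const
      c₁).congr_deriv ?_) (Filter.eventuallyEq_of_mem hn fun u hu => (hγ u hu).1)
    rw [hF]; ring
  · refine HasDerivAt.congr_of_eventuallyEq (((hβs.cos.const_mul (μ * sin α)).neg.add_const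
      c₂).congr_deriv ?_) (Filter.eventuallyEq_of_mem hn fun u hu => (hγ u hu).2.1)
    rw [hF]; ring
  · refine HasDerivAt.congr_of_eventuallyEq ((((hβs.const_mul (ℓ / (4 * m))).add
      ((hasDerivAt_id s).const_mul (slope m ℓ α ζ))).add_const c₃).congr_deriv ?_)
      (Filter.eventuallyEq_of_mem hn fun u hu => (hγ u hu).2.2)
    rw [(hγ s hs).1, (hγ s hs).2.1, slope]
    field_simp
    linear_combination (-4 * m * ℓ * μ * sin α ^ 2) * e1
  · refine (hβs.cos.const_mul (sin α)).congr_deriv ?_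
    rw [(hγ s hs).1, (hγ s hs).2.1]
    linear_combination (2 * m * μ * sin α ^ 3 * sin (β s)) * e1
  · refine (hβs.sin.const_mul (sin α)).congr_deriv ?_
    rw [(hγ s hs).1, (hγ s hs).2.1]
    linear_combination (-2 * m * μ * sin α ^ 3 * cos (β s)) * e1
  · linear_combination sin α ^ 2 * e1 + sin_sq_add_cos_sq α

/-- A unit speed curve whose tangent has constant frame components. -/
theorem isConstAngle_of_const {m ℓ a ζ p q : ℝ} {I : Set ℝ} {γ : ℝ → Vec3}
    (hpq : p ^ 2 + q ^ 2 = 1 - a ^ 2)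
    (hx : ∀ s ∈ I, HasDerivAt (fun t => γ t 0) (conf m (γ s) * p) s)
    (hy : ∀ s ∈ I, HasDerivAt (fun t => γ t 1) (conf m (γ s) * q) s)
    (hz : ∀ s ∈ I, HasDerivAt (fun t => γ t 2) (a + ℓ / 2 * (γ s 0 * q - γ s 1 * p)) s)
    (hG : ∀ s ∈ I, 2 * m * (γ s 0 * q - γ s 1 * p) + ℓ * a + ζ = 0) :
    IsConstAngle m ℓ a ζ I γ := by
  refine ⟨fun _ => p, fun _ => q, fun s hs => ⟨hx s hs, hy s hs, hz s hs, ?_, ?_, hpq⟩⟩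
  · exact (hasDerivAt_const s p).congr_deriv (by rw [hG s hs]; ring)
  · exact (hasDerivAt_const s q).congr_deriv (by rw [hG s hs]; ring)

theorem IsTypeII.isConstAngle {m ℓ α ζ : ℝ} (hm : m ≠ 0) (hα : sin α ≠ 0) {I : Set ℝ}
    (hI : IsOpen I) {γ : ℝ → Vec3} (h : IsTypeII m ℓ α ζ I γ) :
    IsConstAngle m ℓ (cos α) ζ I γ := by
  obtain ⟨β₀, c₁, c₂, hβ, hc, hγ⟩ := h
  have hcos : cos β₀ ≠ 0 := right_ne_zero_of_mul hβ
  have hG : ∀ s ∈ I, 2 * m * (γ s 0 * (sin α * sin β₀) - γ s 1 * (sin α * cos β₀))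
      + ℓ * cos α + ζ = 0 := fun s hs => by
    rw [(hγ s hs).2.1, hc, tan_eq_sin_div_cos]
    field_simp
    ring
  have hx : ∀ s ∈ I, HasDerivAt (fun t => γ t 0) (conf m (γ s) * (sin α * cos β₀)) s :=
    fun s hs => (hγ s hs).1.congr_deriv (by rw [conf, (hγ s hs).2.1])
  refine isConstAngle_of_const (p := sin α * cos β₀) (q := sin α * sin β₀) ?_ hx
    (fun s hs => ?_) (fun s hs => ?_) hG
  · linear_combination sin α ^ 2 * sin_sq_add_cos_sq β₀ + sin_sq_add_cos_sq α
  · refine HasDerivAt.congr_of_eventuallyEq ((((hx s hs).mul_const (tan β₀)).add_const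
      c₁).congr_deriv ?_) (Filter.eventuallyEq_of_mem (hI.mem_nhds hs) fun u hu => (hγ u hu).2.1)
    rw [tan_eq_sin_div_cos]
    field_simp
  · refine HasDerivAt.congr_of_eventuallyEq ((((hasDerivAt_id s).const_mul
      (slope m ℓ α ζ)).add_const c₂).congr_deriv ?_)
      (Filter.eventuallyEq_of_mem (hI.mem_nhds hs) fun u hu => (hγ u hu).2.2)
    rw [slope]
    field_simp
    linear_combination (-2 * ℓ) * hG s hs

/-- The equation `(f')² = g²` determines `f'` up to a constant sign where `g` does not vanish. -/
theorem exists_sign {I : Set ℝ} (hc : I.OrdConnected) {f g : ℝ → ℝ} (hf : ContinuousOn f I)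
    (hg : ContinuousOn g I) (hsq : ∀ s ∈ I, f s ^ 2 = g s ^ 2) (hg0 : ∀ s ∈ I, g s ≠ 0) :
    ∃ e : ℝ, e ^ 2 = 1 ∧ ∀ s ∈ I, f s = e * g s := by
  rcases hc.isPreconnected.eq_or_eq_neg_of_sq_eq hf hg hsq (fun {s} hs => hg0 s hs) with h | h
  · exact ⟨1, by norm_num, fun s hs => by rw [h hs, one_mul]⟩
  · exact ⟨-1, by norm_num, fun s hs => by rw [h hs, Pi.neg_apply, neg_one_mul]⟩

/-- The constants of a curve of Type III traversed with sign `e` solve the quartic. -/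
theorem helixQuartic_of_sign {m ℓ n α ζ e a : ℝ} (hm : m ≠ 0) (he : e ^ 2 = 1)
    (ha : a = slope m ℓ α ζ + ℓ / (4 * m) * (ζ + ℓ * cos α) * e) (hunit : a ^ 2 = cos α ^ 2)
    (hQ : helixQuartic m ℓ n (cos α) ζ = 0) :
    helixQuartic m ℓ n a ((ζ + ℓ * cos α) * e - ℓ * a) = 0 := by
  have hcos : slope m ℓ α ζ = cos α - ℓ / (4 * m) * (ζ + ℓ * cos α) := by
    rw [slope]; field_simp; ring
  rcases sq_eq_one_iff.1 he with rfl | rfl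
  · have h1 : a = cos α := by rw [ha, hcos]; ring
    rw [h1, show (ζ + ℓ * cos α) * 1 - ℓ * cos α = ζ by ring]
    exact hQ
  rcases sq_eq_sq_iff_eq_or_eq_neg.1 hunit with h1 | h1
  · have h2 : ℓ * (ζ + ℓ * cos α) = 0 := by
      rw [hcos, h1] at ha
      field_simp at ha
      linear_combination (1 / 2) * ha
    rcases mul_eq_zero.1 h2 with rfl | h3
    · rw [h1, show (ζ + 0 * cos α) * -1 - 0 * cos α = -ζ by ring]
      refine Eq.trans ?_ hQ
      unfold helixQuartic
      ring
    · rw [h1, show (ζ + ℓ * cos α) * -1 - ℓ * cos α = ζ by linear_combination (-2) * h3]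
      exact hQ
  · rw [h1, show (ζ + ℓ * cos α) * -1 - ℓ * -cos α = -ζ by ring, helixQuartic_neg]
    exact hQ

/-- The unit speed condition in terms of the frame components `p, q, a` of the tangent vector. -/
theorem IsFrenetCurve3.sq_of_hasDerivAt {m ℓ p q a : ℝ} {I : Set ℝ} {γ N B : ℝ → Vec3}
    {k₁ k₂ : ℝ → ℝ} (h : IsFrenetCurve3 (metric m ℓ) (domain m) I γ N B k₁ k₂) {s : ℝ}
    (hs : s ∈ I)
    (hx : HasDerivAt (fun t => γ t 0) (conf m (γ s) * p) s)
    (hy : HasDerivAt (fun t => γ t 1) (conf m (γ s) * q) s)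
    (hz : HasDerivAt (fun t => γ t 2) (a + ℓ / 2 * (γ s 0 * q - γ s 1 * p)) s) :
    p ^ 2 + q ^ 2 = 1 - a ^ 2 := by
  have h1 := (h.isOrthoFrame hs).tt
  rw [frameCoord_tangent (h.conf_pos hs).ne' hx hy hz] at h1
  simp [dotProduct, Fin.sum_univ_three] at h1
  linarith

theorem continuousOn_deriv_coord {I : Set ℝ} (hI : IsOpen I) {γ : ℝ → Vec3}
    (hγ : ContDiffOn ℝ (⊤ : ℕ∞) γ I) (i : Fin 3) : ContinuousOn (deriv fun t => γ t i) I :=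
  (contDiffOn_pi.1 (contDiffOn_tangent hI hγ) i).continuousOn

theorem continuousOn_conf (m : ℝ) {I : Set ℝ} {γ : ℝ → Vec3} (hγ : ContinuousOn γ I) :
    ContinuousOn (fun s => conf m (γ s)) I := by
  have h : Continuous (conf m) := by unfold conf; fun_prop
  exact h.comp_continuousOn hγ

/-- On a curve of Type III the sign of `x'` or `y'` is not prescribed, so that the constants of the
curve need not be those of the type. -/
theorem IsTypeIII.exists_isConstAngle {m ℓ α ζ n : ℝ} (hm : m ≠ 0) (hα : sin α ≠ 0) {I : Set ℝ}
    (hI : IsOpen I) (hc : I.OrdConnected) (hne : I.Nonempty) {γ N B : ℝ → Vec3} {k₁ k₂ : ℝ → ℝ}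
    (hγ : IsFrenetCurve3 (metric m ℓ) (domain m) I γ N B k₁ k₂)
    (hQ : helixQuartic m ℓ n (cos α) ζ = 0) (h : IsTypeIII m ℓ α ζ I γ) :
    ∃ a ζ', helixQuartic m ℓ n a ζ' = 0 ∧ IsConstAngle m ℓ a ζ' I γ := by
  obtain ⟨s₀, hs₀⟩ := hne
  obtain ⟨β₀, c₁, hz, h⟩ := h
  have hz' : ∀ s ∈ I, HasDerivAt (fun t => γ t 2) (slope m ℓ α ζ) s := fun s hs =>
    HasDerivAt.congr_of_eventuallyEq ((((hasDerivAt_id s).const_mul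
      (slope m ℓ α ζ)).add_const c₁).congr_deriv (by simp))
      (Filter.eventuallyEq_of_mem (hI.mem_nhds hs) hz)
  have hF := continuousOn_conf m hγ.smooth.continuousOn
  have hF0 : ∀ s ∈ I, conf m (γ s) * sin α ≠ 0 := fun s hs =>
    mul_ne_zero (hγ.conf_pos hs).ne' hα
  have e1 := sin_sq_add_cos_sq β₀
  rcases h with ⟨h0, x₀, hx₀, h⟩ | ⟨h0, y₀, hy₀, h⟩
  · obtain ⟨e, he, hd⟩ := exists_sign hc (continuousOn_deriv_coord hI hγ.smooth 1)
      (hF.mul_const (sin α)) (fun s hs => by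
        rw [(h s hs).2.2, conf, (h s hs).1]; ring) hF0
    have hsin : sin β₀ ^ 2 = 1 := by rw [h0] at e1; linarith
    have hsin0 : sin β₀ ≠ 0 := fun h => by rw [h] at hsin; norm_num at hsin
    have hx : ∀ s ∈ I, HasDerivAt (fun t => γ t 0) (conf m (γ s) * 0) s := fun s hs =>
      HasDerivAt.congr_of_eventuallyEq ((hasDerivAt_const s x₀).congr_deriv (by simp))
        (Filter.eventuallyEq_of_mem (hI.mem_nhds hs) fun u hu => (h u hu).1)
    have hy : ∀ s ∈ I, HasDerivAt (fun t => γ t 1) (conf m (γ s) * (e * sin α)) s :=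
      fun s hs => (h s hs).2.1.hasDerivAt.congr_deriv (by rw [hd s hs]; ring)
    have hx₀' : x₀ = -((ζ + ℓ * cos α) * sin β₀ / (2 * m * sin α)) := by
      rw [hx₀]
      field_simp
      linear_combination (ζ + ℓ * cos α) * hsin
    have hz2 : ∀ s ∈ I, HasDerivAt (fun t => γ t 2) (slope m ℓ α ζ
        + ℓ / (4 * m) * (ζ + ℓ * cos α) * (e * sin β₀)
        + ℓ / 2 * (γ s 0 * (e * sin α) - γ s 1 * 0)) s := fun s hs =>
      (hz' s hs).congr_deriv (by rw [(h s hs).1, hx₀']; field_simp; ring)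
    have hu := hγ.sq_of_hasDerivAt hs₀ (hx s₀ hs₀) (hy s₀ hs₀) (hz2 s₀ hs₀)
    refine ⟨_, _, helixQuartic_of_sign hm (e := e * sin β₀) (by rw [mul_pow, he, hsin, one_mul])
      rfl ?_ hQ, isConstAngle_of_const hu hx hy hz2 fun s hs => ?_⟩
    · linear_combination hu - sin α ^ 2 * he - sin_sq_add_cos_sq α
    · rw [(h s hs).1, hx₀']
      field_simp
      ring
  · obtain ⟨e, he, hd⟩ := exists_sign hc (continuousOn_deriv_coord hI hγ.smooth 0)
      (hF.mul_const (sin α)) (fun s hs => by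
        rw [(h s hs).2.2, conf, (h s hs).1]; ring) hF0
    have hcos : cos β₀ ^ 2 = 1 := by rw [h0] at e1; linarith
    have hcos0 : cos β₀ ≠ 0 := fun h => by rw [h] at hcos; norm_num at hcos
    have hy : ∀ s ∈ I, HasDerivAt (fun t => γ t 1) (conf m (γ s) * 0) s := fun s hs =>
      HasDerivAt.congr_of_eventuallyEq ((hasDerivAt_const s y₀).congr_deriv (by simp))
        (Filter.eventuallyEq_of_mem (hI.mem_nhds hs) fun u hu => (h u hu).1)
    have hx : ∀ s ∈ I, HasDerivAt (fun t => γ t 0) (conf m (γ s) * (e * sin α)) s :=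
      fun s hs => (h s hs).2.1.hasDerivAt.congr_deriv (by rw [hd s hs]; ring)
    have hy₀' : y₀ = (ζ + ℓ * cos α) * cos β₀ / (2 * m * sin α) := by
      rw [hy₀]
      field_simp
      linear_combination (-(ζ + ℓ * cos α)) * hcos
    have hz2 : ∀ s ∈ I, HasDerivAt (fun t => γ t 2) (slope m ℓ α ζ
        + ℓ / (4 * m) * (ζ + ℓ * cos α) * (e * cos β₀)
        + ℓ / 2 * (γ s 0 * 0 - γ s 1 * (e * sin α))) s := fun s hs =>
      (hz' s hs).congr_deriv (by rw [(h s hs).1, hy₀']; field_simp; ring)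
    have hu := hγ.sq_of_hasDerivAt hs₀ (hx s₀ hs₀) (hy s₀ hs₀) (hz2 s₀ hs₀)
    refine ⟨_, _, helixQuartic_of_sign hm (e := e * cos β₀) (by rw [mul_pow, he, hcos, one_mul])
      rfl ?_ hQ, isConstAngle_of_const hu hx hy hz2 fun s hs => ?_⟩
    · linear_combination hu - sin α ^ 2 * he - sin_sq_add_cos_sq α
    · rw [(h s hs).1, hy₀']
      field_simp
      ring

end BCV

end

theorem mainTheorem7 (m ℓ : ℝ) (hm : m ≠ 0) (hmℓ : 4 * m ≠ ℓ ^ 2) (r : ℕ) (hr : 2 ≤ r) :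
    (∀ (I : Set ℝ) (γ : ℝ → BCV.Vec3) (α ζ : ℝ),
      IsOpen I → I.OrdConnected → I.Nonempty →
      BCV.IsFrenetHelix3 (BCV.metric m ℓ) (BCV.domain m) I γ →
      0 < α → α < Real.pi → 0 < ζ → BCV.P4 m ℓ r α ζ = 0 →
      BCV.IsTypeIToIII m ℓ α ζ I γ →
      BCV.IsProperRHarmonicOn (BCV.metric m ℓ) r I γ) ∧
    (∀ (I : Set ℝ) (γ : ℝ → BCV.Vec3),
      IsOpen I → I.OrdConnected → I.Nonempty →
      BCV.IsFrenetHelix3 (BCV.metric m ℓ) (BCV.domain m) I γ →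
      BCV.IsProperRHarmonicOn (BCV.metric m ℓ) r I γ →
      ∃ α ζ : ℝ, 0 < α ∧ α < Real.pi ∧ 0 < ζ ∧ BCV.P4 m ℓ r α ζ = 0 ∧
        (BCV.IsTypeIToIII m ℓ α ζ I γ ∨
          BCV.IsTypeIToIII m ℓ α ζ {s | -s ∈ I} (fun s => γ (-s)))) := by
  obtain ⟨n, rfl⟩ : ∃ n, r = n + 2 := ⟨r - 2, by omega⟩
  refine ⟨fun I γ α ζ hI hc hne ⟨N, B, κ, τ, hγ⟩ hα0 hαπ _ hP hty => ?_,
    fun I γ hI hc hne ⟨N, B, κ, τ, hγ⟩ ⟨hτ, _⟩ => ?_⟩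
  · have hα : Real.sin α ≠ 0 := (Real.sin_pos_of_pos_of_lt_pi hα0 hαπ).ne'
    have hQ : BCV.helixQuartic m ℓ n (Real.cos α) ζ = 0 := by
      rw [BCV.P4_eq] at hP
      linarith
    obtain ⟨a, ζ', hQ', hca⟩ : ∃ a ζ', BCV.helixQuartic m ℓ n a ζ' = 0 ∧
        BCV.IsConstAngle m ℓ a ζ' I γ := by
      rcases hty with h | h | h
      · exact ⟨_, _, hQ, h.isConstAngle hm hI⟩
      · exact ⟨_, _, hQ, h.isConstAngle hm hα hI⟩
      · exact h.exists_isConstAngle hm hα hI hc hne hγ hQ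
    exact ⟨fun s hs => (hγ.rTension_eq_zero_iff_helixQuartic hI hca n hs).2 hQ',
      hγ.not_isGeodesicOn hne⟩
  · obtain ⟨a, ζ, ha, hζ, hQ, hca⟩ := hγ.exists_isConstAngle hmℓ hI hc hne hτ
    have hF : ∀ s ∈ I, BCV.conf m (γ s) ≠ 0 := fun s hs => (hγ.conf_pos hs).ne'
    have harccos : ∀ {b : ℝ}, b ^ 2 < 1 → 0 < Real.arccos b ∧ Real.arccos b < Real.pi ∧
        Real.cos (Real.arccos b) = b := fun {b} hb => by
      obtain ⟨h1, h2⟩ := abs_lt.1 ((sq_lt_one_iff_abs_lt_one b).1 hb)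
      exact ⟨Real.arccos_pos.2 h2, Real.arccos_lt_pi.2 h1, Real.cos_arccos h1.le h2.le⟩
    rcases lt_or_gt_of_ne hζ with hneg | hpos
    · obtain ⟨h1, h2, h3⟩ := harccos (b := -a) (by rwa [neg_sq])
      refine ⟨Real.arccos (-a), -ζ, h1, h2, neg_pos.2 hneg, ?_, Or.inr ?_⟩
      · rw [BCV.P4_eq, h3, BCV.helixQuartic_neg, hQ, mul_zero]
      · refine BCV.isTypeIToIII_of_isConstAngle hm (Real.sin_pos_of_pos_of_lt_pi h1 h2)
          (hI.preimage continuous_neg) ?_ ?_ (fun s hs => hF (-s) hs) (h3.symm ▸ hca.reverse)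
        · exact ⟨fun x hx y hy z hz => hc.out hy hx ⟨neg_le_neg hz.2, neg_le_neg hz.1⟩⟩
        · obtain ⟨s, hs⟩ := hne
          exact ⟨-s, by simpa using hs⟩
    · obtain ⟨h1, h2, h3⟩ := harccos ha
      refine ⟨Real.arccos a, ζ, h1, h2, hpos, ?_, Or.inl ?_⟩
      · rw [BCV.P4_eq, h3, hQ, mul_zero]
      · exact BCV.isTypeIToIII_of_isConstAngle hm (Real.sin_pos_of_pos_of_lt_pi h1 h2)
          hI hc hne hF (h3.symm ▸ hca)
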